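/- Let $A,B,C$ be finite-dimensional complex vector spaces and let $X=\mathrm{Seg}(\mathbb PA\times\mathbb PB\times\mathbb PC)\subset\mathbb P(A\otimes B\otimes C)$ be the Segre variety of classes of nonzero decomposable tensors $a\otimes b\otimes c$. The rank $R(p)$ of a point $p\in\mathbb P(A\otimes B\otimes C)$ is the smallest $r$ such that $p$ lies in the linear span of $r$ points of $X$, and $\sigma_3(X)$ is the Zariski closure of the set of points of rank at most $3$. (1) Let $y(t)$ be a holomorphic curve, defined near $t=0$, on the affine cone over $X$, and suppose that $y(0)+y'(0)+y''(0)\neq 0$. Then the point $p=[y(0)+y'(0)+y''(0)]$ lies in $\sigma_3(X)$. If moreover $p$ is nondegenerate, in the sense that $p$ lies in none of the spaces $\mathbb P(A'\otimes B\otimes C)$, $\mathbb P(A\otimes B'\otimes C)$, $\mathbb P(A\otimes B\otimes C')$ with $A'\subseteq A$, $B'\subseteq B$, $C'\subseteq C$ subspaces of dimension at most $2$, then $R(p)=5$. (2) Every point of $\sigma_3(X)$ has rank at most $5$; and if $\dim A,\dim B,\dim C\geq 3$, then some point of $\sigma_3(X)$ has rank exactly $5$, so that the maximum rank of a point of $\sigma_3(X)$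 is $5$. -/

import Mathlib

open scoped TensorProduct Topology

namespace SegreSecant

section General

variable {V : Type*} [AddCommGroup V] [Module ℂ V]

/-- A homogeneous form on `V` is written as a homogeneous polynomial in linear functionals on `V`;
this is its value at the vector `v`. -/
noncomputable def formEval (f : MvPolynomial (Module.Dual ℂ V) ℂ) (v : V) : ℂ :=
  MvPolynomial.eval (fun φ : Module.Dual ℂ V => φ v) f

/-- The Zariski closure of a subset `S` of the projective space `ℙ V`: the points at which every
homogeneous form vanishing on `S` vanishes. -/
def zariskiClosure (S : Set (Projectivization ℂ V)) : Set (Projectivization ℂ V) :=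
  {p | ∀ (d : ℕ) (f : MvPolynomial (Module.Dual ℂ V) ℂ), f.IsHomogeneous d →
    (∀ s ∈ S, formEval f s.rep = 0) → formEval f p.rep = 0}

/-- `p` lies in the span of `r` (not necessarily distinct) points of `X`. -/
def RankLE (X : Set (Projectivization ℂ V)) (r : ℕ) (p : Projectivization ℂ V) : Prop :=
  ∃ x : Fin r → Projectivization ℂ V, (∀ i, x i ∈ X) ∧ p.submodule ≤ ⨆ i, (x i).submodule

/-- The `X`-rank of `p`: the smallest `r` such that `p` lies in the span of `r` points of `X`
(`⊤` if there is none). -/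
noncomputable def rank (X : Set (Projectivization ℂ V)) (p : Projectivization ℂ V) : ℕ∞ :=
  ⨅ (r : ℕ) (_ : RankLE X r p), (r : ℕ∞)

/-- The `r`-th secant variety `σ_r(X)`: the Zariski closure of the set of points of `X`-rank
at most `r`. -/
def secantVariety (r : ℕ) (X : Set (Projectivization ℂ V)) : Set (Projectivization ℂ V) :=
  zariskiClosure {p | rank X p ≤ r}

/-- The affine cone over `X` (with its vertex `0`). -/
def affineCone (X : Set (Projectivization ℂ V)) : Set V :=
  {v | ∀ h : v ≠ 0, Projectivization.mk ℂ v h ∈ X}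

/-- `p = [y + y' + y'']`, where `y = y(0)`, `y' = y'(0)`, `y'' = y''(0)` for a holomorphic curve
`y(t)` (defined near `t = 0`) on the affine cone over `X`. Holomorphy and derivatives are tested by
linear functionals, which for a finite-dimensional `V` is the usual notion. -/
def IsSecondOrderPoint (X : Set (Projectivization ℂ V)) (p : Projectivization ℂ V) : Prop :=
  ∃ (y : ℂ → V) (y₁ y₂ : V),
    (∀ φ : Module.Dual ℂ V, AnalyticAt ℂ (fun t => φ (y t)) 0) ∧
    (∀ᶠ t in 𝓝 (0 : ℂ), y t ∈ affineCone X) ∧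
    (∀ φ : Module.Dual ℂ V, φ y₁ = deriv (fun t => φ (y t)) 0) ∧
    (∀ φ : Module.Dual ℂ V, φ y₂ = iteratedDeriv 2 (fun t => φ (y t)) 0) ∧
    ∃ h : y 0 + y₁ + y₂ ≠ 0, p = Projectivization.mk ℂ (y 0 + y₁ + y₂) h

end General

section Segre

variable (A B C : Type*) [AddCommGroup A] [Module ℂ A] [AddCommGroup B] [Module ℂ B]
  [AddCommGroup C] [Module ℂ C]

/-- The Segre variety `Seg(ℙA × ℙB × ℙC)` of decomposable tensors in `ℙ(A ⊗ B ⊗ C)`. -/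
def segre : Set (Projectivization ℂ (A ⊗[ℂ] B ⊗[ℂ] C)) :=
  {p | ∃ (a : A) (b : B) (c : C) (h : a ⊗ₜ[ℂ] b ⊗ₜ[ℂ] c ≠ 0),
    p = Projectivization.mk ℂ (a ⊗ₜ[ℂ] b ⊗ₜ[ℂ] c) h}

variable {A B C}

/-- `p` lies in `ℙ(A' ⊗ B ⊗ C)`, in `ℙ(A ⊗ B' ⊗ C)` or in `ℙ(A ⊗ B ⊗ C')` only for subspaces
`A'`, `B'`, `C'` of dimension at least three. -/
def IsNondegenerate (p : Projectivization ℂ (A ⊗[ℂ] B ⊗[ℂ] C)) : Prop :=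
  (∀ A' : Submodule ℂ A,
    p.submodule ≤ LinearMap.range (TensorProduct.map (TensorProduct.map A'.subtype
      (LinearMap.id : B →ₗ[ℂ] B)) (LinearMap.id : C →ₗ[ℂ] C)) → 3 ≤ Module.finrank ℂ A') ∧
  (∀ B' : Submodule ℂ B,
    p.submodule ≤ LinearMap.range (TensorProduct.map (TensorProduct.map
      (LinearMap.id : A →ₗ[ℂ] A) B'.subtype) (LinearMap.id : C →ₗ[ℂ] C)) →
        3 ≤ Module.finrank ℂ B') ∧
  (∀ C' : Submodule ℂ C,
    p.submodule ≤ LinearMap.range (TensorProduct.map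
      (LinearMap.id : A ⊗[ℂ] B →ₗ[ℂ] A ⊗[ℂ] B) C'.subtype) → 3 ≤ Module.finrank ℂ C')

end Segre

end SegreSecant

/-! Upper bound. Two families of forms vanish on tensors of rank at most three, hence on
`secantVariety 3`: the 4 × 4 minors of the three flattenings, and Strassen's equations `X adj(Z) Y =
Y adj(Z) X` between slices. The minors reduce the tensor to a 3 × 3 × 3 array; Strassen's equations
then bound its rank by five (`ArrayRankLE.of_isStrassen`). If the slice space contains an invertible
`Z`, multiplying by `Z⁻¹` makes it commutative: either it becomes a space of Hankel matrices, or all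
its elements are scalars plus matrices of rank one. If all slices are singular, then five rank-one
matrices span them directly or they share a left or right kernel vector, which leaves a pencil, for
which Strassen's equations hold automatically.

Lower bound. If `y 0 ≠ 0`, then `y + y' + y''` is an `osculatingTensor`, and nondegeneracy makes its
three triples of vectors independent. The substitution method excludes four summands: a functional
killing two of them leaves a matrix of rank at most two whose determinant is `-2`. If `y 0 = 0`, the
point lies in `secantVariety 2` and is degenerate.

Membership in `secantVariety 3` comes from finite differences of `y 0`, `y t`, `y (-t)`. -/

namespace SegreSecant

/-! ### Spanning families of prescribed size. -/

section LinearAlgebra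

variable {V : Type*} [AddCommGroup V] [Module ℂ V]

theorem exists_coordinates (S : Submodule ℂ V) [FiniteDimensional ℂ S] {r : ℕ}
    (h : Module.finrank ℂ S ≤ r) :
    ∃ (m : Fin r → V) (α : Fin r → Module.Dual ℂ V),
      (∀ i, m i ∈ S) ∧ ∀ x ∈ S, ∑ i, α i x • m i = x := by
  obtain ⟨k, rfl⟩ := Nat.exists_eq_add_of_le h
  let b := Module.finBasis ℂ S
  choose g hg using fun i => LinearMap.exists_extend (b.coord i)
  refine ⟨Fin.append (fun i => (b i : V)) 0, Fin.append g 0, fun i => ?_, fun x hx => ?_⟩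
  · refine Fin.addCases (fun i => ?_) (fun i => ?_) i <;> simp
  · have h1 : ∀ i, g i x = b.repr ⟨x, hx⟩ i := fun i => by
      have := LinearMap.congr_fun (hg i) ⟨x, hx⟩
      simpa using this
    have h2 := congrArg Subtype.val (b.sum_repr ⟨x, hx⟩)
    rw [AddSubmonoidClass.coe_finsetSum] at h2
    simpa only [Fin.sum_univ_add, Fin.append_left, Fin.append_right, Pi.zero_apply, smul_zero,
      Finset.sum_const_zero, add_zero, h1] using! h2

theorem exists_le_span_of_finrank_le (S : Submodule ℂ V) [FiniteDimensional ℂ S] {r : ℕ}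
    (h : Module.finrank ℂ S ≤ r) :
    ∃ m : Fin r → V, (∀ i, m i ∈ S) ∧ S ≤ Submodule.span ℂ (Set.range m) := by
  obtain ⟨m, α, hm, hα⟩ := exists_coordinates S h
  exact ⟨m, hm, fun x hx => (Submodule.mem_span_range_iff_exists_fun ℂ).2 ⟨_, hα x hx⟩⟩

theorem exists_le_span_triple (W : Submodule ℂ V) [FiniteDimensional ℂ W]
    (h : Module.finrank ℂ W ≤ 3) {z : V} (hz : z ∈ W) (hz0 : z ≠ 0) :
    ∃ x ∈ W, ∃ y ∈ W, W ≤ Submodule.span ℂ {z, x, y} := by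
  let f := (Submodule.span ℂ {z}).mkQ
  have hfz : f z = 0 := by simp [f]
  have hker : 0 < Module.finrank ℂ (f.domRestrict W).ker := by
    rw [Module.finrank_pos_iff_exists_ne_zero]
    exact ⟨⟨⟨z, hz⟩, by simpa using hfz⟩, by simpa using hz0⟩
  have hd := LinearMap.finrank_range_add_finrank_ker (f.domRestrict W)
  obtain ⟨m, hm, hs⟩ := exists_le_span_of_finrank_le (f.domRestrict W).range (r := 2) (by omega)
  choose n hn using hm
  refine ⟨n 0, (n 0).2, n 1, (n 1).2, fun w hw => ?_⟩
  obtain ⟨c, hc⟩ := (Submodule.mem_span_range_iff_exists_fun ℂ).1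
    (hs ⟨(⟨w, hw⟩ : W), rfl⟩)
  have h0 : w - (c 0 • (n 0 : V) + c 1 • (n 1 : V)) ∈ Submodule.span ℂ {z} := by
    rw [← Submodule.Quotient.mk_eq_zero, ← Submodule.mkQ_apply]
    simp only [Fin.sum_univ_two, ← hn, LinearMap.domRestrict_apply] at hc
    simp [f, ← hc, map_sub]
  obtain ⟨d, hd⟩ := Submodule.mem_span_singleton.1 h0
  rw [Submodule.mem_span_triple]
  exact ⟨d, c 0, c 1, by rw [hd]; abel⟩

end LinearAlgebra

/-! ### Commuting 3 × 3 matrices and spans of rank-one matrices. -/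

section Matrices

open Matrix

/-- `W` is contained in the span of `r` matrices of rank at most one. -/
def HasSpan (r : ℕ) (W : Submodule ℂ (Matrix (Fin 3) (Fin 3) ℂ)) : Prop :=
  ∃ u v : Fin r → Fin 3 → ℂ, W ≤ Submodule.span ℂ (Set.range fun l => vecMulVec (u l) (v l))

/-- Multiplication by `P` on the left and by `Q` on the right. -/
def mulLeftRight (P Q : Matrix (Fin 3) (Fin 3) ℂ) :
    Matrix (Fin 3) (Fin 3) ℂ →ₗ[ℂ] Matrix (Fin 3) (Fin 3) ℂ :=
  LinearMap.mulRight ℂ Q ∘ₗ LinearMap.mulLeft ℂ P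

@[simp] theorem mulLeftRight_apply (P Q X : Matrix (Fin 3) (Fin 3) ℂ) :
    mulLeftRight P Q X = P * X * Q := rfl

theorem HasSpan.of_map {r : ℕ} {W : Submodule ℂ (Matrix (Fin 3) (Fin 3) ℂ)}
    {P Q : Matrix (Fin 3) (Fin 3) ℂ} (hP : IsUnit P) (hQ : IsUnit Q)
    (h : HasSpan r (W.map (mulLeftRight P Q))) : HasSpan r W := by
  obtain ⟨u, v, h⟩ := h
  refine ⟨fun l => P⁻¹ *ᵥ u l, fun l => v l ᵥ* Q⁻¹, fun X hX => ?_⟩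
  obtain ⟨c, hc⟩ := (Submodule.mem_span_range_iff_exists_fun ℂ).1
    (h (Submodule.mem_map_of_mem hX))
  refine (Submodule.mem_span_range_iff_exists_fun ℂ).2 ⟨c, ?_⟩
  have h1 : X = P⁻¹ * (P * X * Q) * Q⁻¹ := by
    rw [Matrix.isUnit_iff_isUnit_det] at hP hQ
    rw [Matrix.mul_assoc P X Q, Matrix.nonsing_inv_mul_cancel_left _ _ hP,
      Matrix.mul_nonsing_inv_cancel_right _ _ hQ]
  rw [h1, ← mulLeftRight_apply P Q X, ← hc]
  simp [Finset.mul_sum, Finset.sum_mul, mul_vecMulVec, vecMulVec_mul]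

theorem exists_vecMulVec_of_rank_le_one {X : Matrix (Fin 3) (Fin 3) ℂ} (h : X.rank ≤ 1) :
    ∃ u v, X = vecMulVec u v := by
  rw [Matrix.rank, finrank_le_one_iff] at h
  obtain ⟨u, hu⟩ := h
  choose c hc using fun j => hu ⟨X *ᵥ Pi.single j 1, LinearMap.mem_range_self X.mulVecLin _⟩
  refine ⟨u, c, ?_⟩
  ext i j
  have := congrFun (congrArg Subtype.val (hc j)) i
  simp at this
  simp [vecMulVec_apply, ← this, mul_comm]

/-- Over `ℂ` the quadratic splits, so `(X - a)(X - b) = 0`. The ranks of the two factors add up to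
at most three, so one of them is at most one. -/
theorem exists_rank_sub_le_one_of_aeval_eq_zero {X : Matrix (Fin 3) (Fin 3) ℂ}
    {q : Polynomial ℂ} (hq : q.Monic) (hd : q.natDegree = 2) (h : Polynomial.aeval X q = 0) :
    ∃ c : ℂ, (X - c • 1).rank ≤ 1 := by
  obtain ⟨a, ha⟩ := IsAlgClosed.exists_root q (by
    rw [Polynomial.degree_eq_natDegree hq.ne_zero, hd]; decide)
  obtain ⟨s, hs⟩ := Polynomial.dvd_iff_isRoot.2 ha
  have hsm : s.Monic := (Polynomial.monic_X_sub_C a).of_mul_monic_left (hs ▸ hq)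
  have hsd : s.natDegree = 1 := by
    rw [hs, (Polynomial.monic_X_sub_C a).natDegree_mul hsm, Polynomial.natDegree_X_sub_C] at hd
    omega
  have hs' := hsm.eq_X_add_C hsd
  rw [hs, hs', map_mul] at h
  simp only [map_sub, map_add, Polynomial.aeval_X, Polynomial.aeval_C,
    Algebra.algebraMap_eq_smul_one] at h
  have hr := Matrix.rank_add_rank_le_card_of_mul_eq_zero h
  simp only [Fintype.card_fin] at hr
  by_cases h1 : (X - a • 1).rank ≤ 1
  · exact ⟨a, h1⟩
  · refine ⟨-(s.coeff 0), ?_⟩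
    rw [neg_smul, sub_neg_eq_add]
    omega

/-- A `3 × 3` matrix has a cyclic vector unless it is a scalar plus a matrix of rank one. -/
theorem exists_cyclic_or_rank_le_one (X : Matrix (Fin 3) (Fin 3) ℂ) :
    (∃ v : Fin 3 → ℂ, LinearIndependent ℂ (fun j : Fin 3 => (X ^ (j : ℕ)) *ᵥ v)) ∨
      ∃ c : ℂ, (X - c • 1).rank ≤ 1 := by
  by_contra! hcon
  obtain ⟨hcyc, hrank⟩ := hcon
  set p := X.charpoly with hp
  have hpm : p.Monic := X.charpoly_monic
  have hpd : p.natDegree = 3 := by simp [hp]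
  have hroot : ∀ a, p.IsRoot a → Polynomial.aeval X (p /ₘ (Polynomial.X - Polynomial.C a)) ≠ 0 := by
    intro a ha h0
    have hs := Polynomial.mul_divByMonic_eq_iff_isRoot.2 ha
    have hsm := (Polynomial.monic_X_sub_C a).of_mul_monic_left (hs.symm ▸ hpm)
    obtain ⟨c, hc⟩ := exists_rank_sub_le_one_of_aeval_eq_zero hsm (by
      rw [Polynomial.natDegree_divByMonic _ (Polynomial.monic_X_sub_C a), hpd]; simp) h0
    exact absurd hc (not_le.2 (hrank c))
  have hfin : Finite {a : ℂ // p.IsRoot a} := by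
    have := Polynomial.finite_setOfPred_isRoot hpm.ne_zero
    exact this
  -- Finitely many proper subspaces do not cover `ℂ³`, so some `v` is killed by no `p / (X - a)`
  -- evaluated at the matrix. This `v` is cyclic.
  have hcover : ¬ (⋃ a : {a : ℂ // p.IsRoot a}, ((Matrix.mulVecLin (Polynomial.aeval X
      (p /ₘ (Polynomial.X - Polynomial.C a.1)))).ker : Set (Fin 3 → ℂ)) = Set.univ) := by
    intro hc
    obtain ⟨⟨a, ha⟩, h⟩ := Subspace.exists_eq_top_of_iUnion_eq_univ hc
    apply hroot a ha
    rw [LinearMap.ker_eq_top] at h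
    exact Matrix.toLin'.injective (h.trans (map_zero _).symm)
  obtain ⟨v, hv⟩ := (Set.ne_univ_iff_exists_notMem _).1 hcover
  simp only [Set.mem_iUnion, not_exists, SetLike.mem_coe, LinearMap.mem_ker, mulVecLin_apply,
    Subtype.forall] at hv
  apply hcyc v
  rw [Fintype.linearIndependent_iff]
  intro g hg
  by_contra! hne
  obtain ⟨i, hi⟩ := hne
  let q : Polynomial ℂ := ∑ j : Fin 3, Polynomial.monomial (j : ℕ) (g j)
  have hq0 : q ≠ 0 := by
    intro h
    apply hi
    have := congrArg (fun f : Polynomial ℂ => f.coeff i) h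
    simpa [q, Polynomial.finsetSum_coeff, Polynomial.coeff_monomial, Fin.val_inj] using this
  have hqd : q.natDegree ≤ 2 := by
    refine Polynomial.natDegree_sum_le_of_forall_le _ _ fun j _ => ?_
    exact (Polynomial.natDegree_monomial_le _).trans (by omega)
  have hqv : Polynomial.aeval X q *ᵥ v = 0 := by
    rw [← hg]
    simp [q, Polynomial.aeval_monomial, Matrix.sum_mulVec, Algebra.algebraMap_eq_smul_one,
      Matrix.smul_mulVec]
  -- `d` kills `v` and has degree at most two, so it is a proper divisor of `p` and divides `p / (X
  -- - a)` for some root `a`, contrary to the choice of `v`.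
  let d := EuclideanDomain.gcd p q
  have hdp : d ∣ p := EuclideanDomain.gcd_dvd_left _ _
  have hdq : d ∣ q := EuclideanDomain.gcd_dvd_right _ _
  have hdv : Polynomial.aeval X d *ᵥ v = 0 := by
    have : d = p * _ + q * _ := EuclideanDomain.gcd_eq_gcd_ab p q
    rw [this, mul_comm q, map_add, map_mul, map_mul, Matrix.aeval_self_charpoly, zero_mul,
      zero_add, ← Matrix.mulVec_mulVec, hqv, Matrix.mulVec_zero]
  obtain ⟨e, he⟩ := hdp
  have hd0 : d ≠ 0 := fun h => hpm.ne_zero (by rw [he, h, zero_mul])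
  have he0 : e ≠ 0 := fun h => hpm.ne_zero (by rw [he, h, mul_zero])
  have hed : e.degree ≠ 0 := by
    have h1 := Polynomial.natDegree_le_of_dvd hdq hq0
    have h2 := Polynomial.natDegree_mul hd0 he0
    rw [← he] at h2
    rw [Polynomial.degree_eq_natDegree he0]
    norm_cast
    omega
  obtain ⟨a, ha⟩ := IsAlgClosed.exists_root e hed
  obtain ⟨s, hs⟩ := Polynomial.dvd_iff_isRoot.2 ha
  have hpa : p.IsRoot a := by
    rw [he]; simp [Polynomial.IsRoot.def.1 ha]
  apply hv a hpa
  have h3 := Polynomial.mul_divByMonic_eq_iff_isRoot.2 hpa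
  have h4 : p /ₘ (Polynomial.X - Polynomial.C a) = s * d := by
    apply mul_left_cancel₀ (Polynomial.X_sub_C_ne_zero a)
    rw [h3, he, hs]; ring
  rw [h4, map_mul, ← Matrix.mulVec_mulVec, hdv, Matrix.mulVec_zero]

/-- Hankel matrices form a five-dimensional space, spanned by the squares of `(1, x, x²)` at the
nodes `0, 1, -1, 2, ∞`. The coefficients at the finite nodes interpolate `s 0, ..., s 3`; the one at
infinity corrects `s 4`. -/
theorem HasSpan.of_hankel {W : Submodule ℂ (Matrix (Fin 3) (Fin 3) ℂ)}
    (h : ∀ X ∈ W, ∃ s : ℕ → ℂ, ∀ i j : Fin 3, X i j = s (i + j)) : HasSpan 5 W := by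
  refine ⟨![![1, 0, 0], ![1, 1, 1], ![1, -1, 1], ![1, 2, 4], ![0, 0, 1]],
    ![![1, 0, 0], ![1, 1, 1], ![1, -1, 1], ![1, 2, 4], ![0, 0, 1]], fun X hX => ?_⟩
  obtain ⟨s, hs⟩ := h X hX
  refine (Submodule.mem_span_range_iff_exists_fun ℂ).2
    ⟨![(s 3 - 2 * s 2 - s 1 + 2 * s 0) / 2, -(s 3 - s 2 - 2 * s 1) / 2,
      -(s 3 - 3 * s 2 + 2 * s 1) / 6, (s 3 - s 1) / 6,
      s 4 + (s 3 - s 2 - 2 * s 1) / 2 + (s 3 - 3 * s 2 + 2 * s 1) / 6 - 16 * ((s 3 - s 1) / 6)], ?_⟩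
  ext i j
  rw [hs]
  fin_cases i <;> fin_cases j <;> simp [Fin.sum_univ_five] <;> ring

/-- In the basis `X ^ j v` and the dual cyclic family `w X ^ i`, the matrix of `Y` has entries `w X
^ i Y X ^ j v = w X ^ (i + j) Y v`, by commutation. Thus `P * Y * Q` is Hankel. -/
theorem HasSpan.of_cyclic {W : Submodule ℂ (Matrix (Fin 3) (Fin 3) ℂ)}
    {X : Matrix (Fin 3) (Fin 3) ℂ} (hX : ∀ Y ∈ W, Commute X Y) {v : Fin 3 → ℂ}
    (hv : LinearIndependent ℂ (fun j : Fin 3 => (X ^ (j : ℕ)) *ᵥ v)) : HasSpan 5 W := by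
  let Q : Matrix (Fin 3) (Fin 3) ℂ := Matrix.of fun i j => ((X ^ (j : ℕ)) *ᵥ v) i
  have hQ : IsUnit Q := Matrix.linearIndependent_cols_iff_isUnit.1 hv
  let w : Fin 3 → ℂ := Q⁻¹ 2
  let P : Matrix (Fin 3) (Fin 3) ℂ := Matrix.of fun i j => (w ᵥ* (X ^ (i : ℕ))) j
  have key : ∀ (Y : Matrix (Fin 3) (Fin 3) ℂ) (i j : Fin 3),
      (P * Y * Q) i j = w ⬝ᵥ ((X ^ (i : ℕ) * Y * X ^ (j : ℕ)) *ᵥ v) := by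
    intro Y i j
    rw [← Matrix.mulVec_mulVec, ← Matrix.mulVec_mulVec, Matrix.dotProduct_mulVec,
      Matrix.dotProduct_mulVec]
    simp only [Matrix.mul_apply', P]
    rfl
  have hPQ : ∀ i j : Fin 3, (P * Q) i j = w ⬝ᵥ ((X ^ ((i : ℕ) + (j : ℕ))) *ᵥ v) := by
    intro i j
    have := key 1 i j
    rwa [Matrix.mul_one, Matrix.mul_one, ← pow_add] at this
  have hw : ∀ j : Fin 3, w ⬝ᵥ ((X ^ (j : ℕ)) *ᵥ v) = (1 : Matrix (Fin 3) (Fin 3) ℂ) 2 j := by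
    intro j
    rw [← Matrix.nonsing_inv_mul Q ((Matrix.isUnit_iff_isUnit_det Q).1 hQ)]
    rfl
  -- As `w` is the last row of `Q⁻¹`, it annihilates `v` and `X v` and takes the value 1 on `X² v`.
  -- Hence `P * Q` has ones on the antidiagonal and zeros above it.
  have hP : IsUnit P := by
    have h1 : IsUnit (P * Q) := by
      rw [Matrix.isUnit_iff_isUnit_det, Matrix.det_fin_three]
      have h0 := hw 0
      have h1 := hw 1
      have h2 := hw 2
      simp at h0 h1 h2
      simp [hPQ, h0, h1, h2]
    exact isUnit_of_mul_isUnit_left h1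
  refine HasSpan.of_map hP hQ (HasSpan.of_hankel ?_)
  rintro _ ⟨Y, hY, rfl⟩
  refine ⟨fun n => w ⬝ᵥ ((X ^ n * Y) *ᵥ v), fun i j => ?_⟩
  rw [mulLeftRight_apply, key]
  simp only
  rw [pow_add, Matrix.mul_assoc, Matrix.mul_assoc,
    ((hX Y hY).pow_left j).eq]

theorem HasSpan.of_commute {W : Submodule ℂ (Matrix (Fin 3) (Fin 3) ℂ)}
    (hd : Module.finrank ℂ W ≤ 3) (h1 : (1 : Matrix (Fin 3) (Fin 3) ℂ) ∈ W)
    (hW : ∀ X ∈ W, ∀ Y ∈ W, Commute X Y) : HasSpan 5 W := by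
  by_cases hc : ∃ X ∈ W, ∃ v : Fin 3 → ℂ,
      LinearIndependent ℂ (fun j : Fin 3 => (X ^ (j : ℕ)) *ᵥ v)
  · obtain ⟨X, hX, v, hv⟩ := hc
    exact HasSpan.of_cyclic (hW X hX) hv
  push Not at hc
  have hdec : ∀ X ∈ W, ∃ (c : ℂ) (u v : Fin 3 → ℂ), X = c • 1 + vecMulVec u v := by
    intro X hX
    obtain ⟨v, hv⟩ | ⟨c, h⟩ := exists_cyclic_or_rank_le_one X
    · exact absurd hv (hc X hX v)
    · obtain ⟨u, v, h⟩ := exists_vecMulVec_of_rank_le_one h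
      exact ⟨c, u, v, by rw [← h]; abel⟩
  obtain ⟨X, hX, Y, hY, hs⟩ := exists_le_span_triple W hd h1 one_ne_zero
  obtain ⟨c, u, v, rfl⟩ := hdec X hX
  obtain ⟨c', u', v', rfl⟩ := hdec Y hY
  -- The three diagonal units produce the scalars; two rank-one matrices account for the other
  -- generators.
  refine ⟨![![1, 0, 0], ![0, 1, 0], ![0, 0, 1], u, u'],
    ![![1, 0, 0], ![0, 1, 0], ![0, 0, 1], v, v'], fun Z hZ => ?_⟩
  obtain ⟨x, y, z, rfl⟩ := Submodule.mem_span_triple.1 (hs hZ)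
  refine (Submodule.mem_span_range_iff_exists_fun ℂ).2
    ⟨![x + y * c + z * c', x + y * c + z * c', x + y * c + z * c', y, z], ?_⟩
  ext i j
  fin_cases i <;> fin_cases j <;> simp [Fin.sum_univ_five, vecMulVec_apply] <;> ring

end Matrices
-- Strassen's condition and spaces of singular matrices.
section SingularSpaces

open Matrix

/-- Strassen's commutation condition on a space of `3 × 3` matrices. -/
def IsStrassen (W : Submodule ℂ (Matrix (Fin 3) (Fin 3) ℂ)) : Prop :=
  ∀ X ∈ W, ∀ Y ∈ W, ∀ Z ∈ W, X * Z.adjugate * Y = Y * Z.adjugate * X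

theorem IsStrassen.map {W : Submodule ℂ (Matrix (Fin 3) (Fin 3) ℂ)} (hW : IsStrassen W)
    (P Q : Matrix (Fin 3) (Fin 3) ℂ) : IsStrassen (W.map (mulLeftRight P Q)) := by
  rintro _ ⟨X, hX, rfl⟩ _ ⟨Y, hY, rfl⟩ _ ⟨Z, hZ, rfl⟩
  have key : ∀ X Y : Matrix (Fin 3) (Fin 3) ℂ, P * X * Q * (P * Z * Q).adjugate * (P * Y * Q) =
      (P.det * Q.det) • (P * (X * Z.adjugate * Y) * Q) := by
    intro X Y
    rw [Matrix.adjugate_mul_distrib, Matrix.adjugate_mul_distrib]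
    calc _ = P * X * (Q * Q.adjugate) * Z.adjugate * (P.adjugate * P) * Y * Q := by
          simp only [Matrix.mul_assoc]
      _ = _ := by
          rw [Matrix.mul_adjugate, Matrix.adjugate_mul]
          simp [Matrix.mul_assoc, smul_smul]
  simp only [mulLeftRight_apply, key]
  rw [hW X hX Y hY Z hZ]

/-- The condition is alternating in `X, Y`, so only `X = E`, `Y = F` matters. With `Z = e E + f F`,
a generator with nonzero coefficient can be traded for `Z`, and `Z` times its adjugate is scalar. -/
theorem IsStrassen.span_pair (E F : Matrix (Fin 3) (Fin 3) ℂ) :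
    IsStrassen (Submodule.span ℂ {E, F}) := by
  intro X hX Y hY Z hZ
  obtain ⟨a, b, rfl⟩ := Submodule.mem_span_pair.1 hX
  obtain ⟨c, d, rfl⟩ := Submodule.mem_span_pair.1 hY
  obtain ⟨e, f, hZ⟩ := Submodule.mem_span_pair.1 hZ
  have h1 : Z * Z.adjugate = Z.det • 1 := Matrix.mul_adjugate Z
  have h2 : Z.adjugate * Z = Z.det • 1 := Matrix.adjugate_mul Z
  have key : E * Z.adjugate * F = F * Z.adjugate * E := by
    by_cases he : e = 0
    · by_cases hf : f = 0
      · subst he hf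
        have : Z = 0 := by rw [← hZ]; simp
        simp [this]
      · apply smul_right_injective _ hf
        have hF : f • F = Z - e • E := by rw [← hZ]; abel
        simp only
        have l : f • (E * Z.adjugate * F) = E * Z.adjugate * (f • F) := by simp
        have r : f • (F * Z.adjugate * E) = (f • F) * Z.adjugate * E := by simp
        rw [l, r, hF, Matrix.mul_sub, Matrix.sub_mul, Matrix.sub_mul, Matrix.mul_assoc E, h1, h2]
        simp
    · apply smul_right_injective _ he
      have hE : e • E = Z - f • F := by rw [← hZ]; abel
      simp only
      have l : e • (E * Z.adjugate * F) = (e • E) * Z.adjugate * F := by simp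
      have r : e • (F * Z.adjugate * E) = F * Z.adjugate * (e • E) := by simp
      rw [l, r, hE, Matrix.mul_sub, Matrix.sub_mul, Matrix.sub_mul, Matrix.mul_assoc F, h1, h2]
      simp
  simp only [Matrix.add_mul, Matrix.mul_add, Matrix.smul_mul, Matrix.mul_smul, key, smul_add,
    smul_smul]
  rw [mul_comm a c, mul_comm b c, mul_comm a d, mul_comm b d]
  abel

/-- A matrix of rank two is equivalent to `diag(1, 1, 0)`. -/
theorem exists_mul_mul_eq_diagonal {M : Matrix (Fin 3) (Fin 3) ℂ} (hM : M.rank = 2) :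
    ∃ P Q : Matrix (Fin 3) (Fin 3) ℂ, IsUnit P ∧ IsUnit Q ∧
      P * M * Q = diagonal ![1, 1, 0] := by
  obtain ⟨P, Q, e, hP, hQ, h⟩ := Matrix.exists_rank_normal_form M
  have h3 : Fintype.card (Fin 3) - M.rank = 1 := by simp [hM]
  let s : Fin 3 ≃ Fin 3 := (finSumFinEquiv (m := 2) (n := 1)).symm.trans
    ((Equiv.sumCongr (finCongr hM.symm) (finCongr h3.symm)).trans e.symm)
  refine ⟨P.submatrix s (Equiv.refl _), Q.submatrix (Equiv.refl _) s,
    (Matrix.isUnit_submatrix_equiv _ _).2 hP, (Matrix.isUnit_submatrix_equiv _ _).2 hQ, ?_⟩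
  have : P.submatrix s (Equiv.refl _) * M * Q.submatrix (Equiv.refl _) s
      = (P * M * Q).submatrix s s := by
    rw [← Matrix.submatrix_mul_equiv (P * M) Q s (Equiv.refl _) s,
      ← Matrix.submatrix_mul_equiv P M s (Equiv.refl _) (Equiv.refl _)]
    simp
  rw [this, h, Matrix.submatrix_submatrix]
  have hs : e ∘ s = (Equiv.sumCongr (finCongr hM.symm) (finCongr h3.symm)) ∘
      (finSumFinEquiv (m := 2) (n := 1)).symm := by
    ext i; simp [s]
  rw [hs]
  have e0 : (finSumFinEquiv (m := 2) (n := 1)).symm 0 = Sum.inl 0 := rfl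
  have e1 : (finSumFinEquiv (m := 2) (n := 1)).symm 1 = Sum.inl 1 := rfl
  have e2 : (finSumFinEquiv (m := 2) (n := 1)).symm 2 = Sum.inr 0 := rfl
  ext i j
  fin_cases i <;> fin_cases j <;>
    simp [e0, e1, e2]

/-- Matrices which map `(u₀, u₁, 0)` and the last basis vector to the line of `(u₀, u₁, 0)`. -/
theorem HasSpan.of_compression {W : Submodule ℂ (Matrix (Fin 3) (Fin 3) ℂ)} {a b : ℂ}
    (hab : a ≠ 0 ∨ b ≠ 0) (h22 : ∀ Y ∈ W, Y 2 2 = 0) (h1 : ∀ Y ∈ W, Y 0 2 * b = Y 1 2 * a)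
    (h2 : ∀ Y ∈ W, Y 2 0 * a + Y 2 1 * b = 0)
    (h3 : ∀ Y ∈ W, a * (Y 1 0 * a + Y 1 1 * b) - b * (Y 0 0 * a + Y 0 1 * b) = 0) :
    HasSpan 5 W := by
  -- With `u = (a, b, 0)`, subtracting a matrix of the form `u ⊗ row` (three parameters) leaves one
  -- killing `u` and the last basis vector, hence a column times `(-b, a, 0)`. That column matters
  -- only modulo `u` and contributes two more.
  by_cases ha : a = 0
  · have hb : b ≠ 0 := by tauto
    subst ha
    refine ⟨![![0, b, 0], ![0, b, 0], ![0, b, 0], ![0, 0, 1], ![1, 0, 0]],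
      ![![1, 0, 0], ![0, 1, 0], ![0, 0, 1], ![-b, 0, 0], ![-b, 0, 0]], fun Y hY => ?_⟩
    have g1 := h1 Y hY
    have g2 := h2 Y hY
    have g3 := h3 Y hY
    simp [hb] at g1 g2 g3
    refine (Submodule.mem_span_range_iff_exists_fun ℂ).2
      ⟨![Y 1 0 / b, Y 1 1 / b, Y 1 2 / b, -Y 2 0 / b, -Y 0 0 / b], ?_⟩
    ext i j
    fin_cases i <;> fin_cases j <;> simp [Fin.sum_univ_five, g1, g2, g3, h22 Y hY] <;> field_simp
  · refine ⟨![![a, b, 0], ![a, b, 0], ![a, b, 0], ![0, 0, 1], ![0, 1, 0]],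
      ![![1, 0, 0], ![0, 1, 0], ![0, 0, 1], ![-b, a, 0], ![-b, a, 0]], fun Y hY => ?_⟩
    have g1 := h1 Y hY
    have g2 := h2 Y hY
    have g3 := h3 Y hY
    refine (Submodule.mem_span_range_iff_exists_fun ℂ).2
      ⟨![Y 0 0 / a, Y 0 1 / a, Y 0 2 / a, Y 2 1 / a, (Y 1 1 - b * Y 0 1 / a) / a], ?_⟩
    ext i j
    fin_cases i <;> fin_cases j <;> simp [Fin.sum_univ_five, h22 Y hY] <;> field_simp <;>
      first | ring1 | linear_combination g1 | linear_combination -g2 | linear_combination -g3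

/-- The adjugate of `diag(1, 1, 0)` is the last diagonal unit, so Strassen's condition makes the
products of last columns with last rows symmetric. Unless all last columns or all last rows vanish,
one `A` has both nonzero and every other last column and row is proportional to those of `A`;
vanishing determinants give the remaining equations of a compression space. -/
theorem trichotomy_of_diagonal_mem {W : Submodule ℂ (Matrix (Fin 3) (Fin 3) ℂ)}
    (hM : diagonal ![1, 1, 0] ∈ W) (hS : IsStrassen W) (hdet : ∀ X ∈ W, X.det = 0) :
    HasSpan 5 W ∨ (∀ X ∈ W, X *ᵥ Pi.single 2 1 = 0) ∨ (∀ X ∈ W, Pi.single 2 1 ᵥ* X = 0) := by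
  have hcoef : ∀ X ∈ W, X 2 2 = 0 ∧ X 0 2 * X 2 0 + X 1 2 * X 2 1 = 0 := by
    intro X hX
    have d0 := hdet X hX
    have d1 := hdet _ (W.add_mem hX hM)
    have d2 := hdet _ (W.sub_mem hX hM)
    simp [Matrix.det_fin_three] at d0 d1 d2
    -- In `det (X + s M)` the coefficient of `s²` is `X 2 2`; given this, the coefficient of `s` is
    -- minus the pairing of the last column with the last row.
    have h22 : X 2 2 = 0 := by linear_combination (d1 + d2) / 2 - d0
    refine ⟨h22, ?_⟩
    linear_combination (d2 - d1) / 2 + (X 0 0 + X 1 1) * h22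
  have hcross : ∀ X ∈ W, ∀ Y ∈ W, ∀ i j, X i 2 * Y 2 j = Y i 2 * X 2 j := by
    intro X hX Y hY i j
    have h := congrFun (congrFun (hS X hX Y hY _ hM) i) j
    simpa [Matrix.adjugate_fin_three, -Matrix.adjugate_diagonal, Matrix.mul_apply, Fin.sum_univ_three] using h
  by_cases hk : ∀ X ∈ W, X 0 2 = 0 ∧ X 1 2 = 0
  · refine Or.inr (Or.inl fun X hX => ?_)
    ext i
    fin_cases i <;> simp [hk X hX, hcoef X hX]
  by_cases hc : ∀ X ∈ W, X 2 0 = 0 ∧ X 2 1 = 0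
  · refine Or.inr (Or.inr fun X hX => ?_)
    ext i
    fin_cases i <;> simp [hc X hX, hcoef X hX]
  left
  push Not at hk hc
  obtain ⟨A, hA, hA'⟩ := hk
  obtain ⟨B, hB, hB'⟩ := hc
  have hu : ∃ i : Fin 3, A i 2 ≠ 0 := by
    by_cases h : A 0 2 = 0
    · exact ⟨1, hA' h⟩
    · exact ⟨0, h⟩
  obtain ⟨i, hi⟩ := hu
  have hw' : ∃ j : Fin 3, A 2 j ≠ 0 := by
    by_contra! h
    have hz : ∀ j, B 2 j = 0 := fun j => by
      have := hcross A hA B hB i j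
      rw [h, mul_zero] at this
      exact (mul_eq_zero.1 this).resolve_left hi
    exact hB' (hz 0) (hz 1)
  obtain ⟨j, hj⟩ := hw'
  have hAw : A 2 0 * A 0 2 + A 2 1 * A 1 2 = 0 := by linear_combination (hcoef A hA).2
  have f1 : ∀ Y ∈ W, Y 0 2 * A 1 2 = Y 1 2 * A 0 2 := fun Y hY => by
    apply mul_right_cancel₀ hj
    linear_combination A 1 2 * hcross Y hY A hA 0 j - A 0 2 * hcross Y hY A hA 1 j
  have f2 : ∀ Y ∈ W, Y 2 0 * A 0 2 + Y 2 1 * A 1 2 = 0 := fun Y hY => by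
    apply mul_left_cancel₀ hi
    linear_combination A 0 2 * hcross A hA Y hY i 0 + A 1 2 * hcross A hA Y hY i 1 +
      Y i 2 * hAw
  have hF : ∀ Y ∈ W, A 0 2 * (Y 1 0 * A 2 1 - Y 1 1 * A 2 0)
      - A 1 2 * (Y 0 0 * A 2 1 - Y 0 1 * A 2 0) = 0 := by
    intro Y hY
    have hAF := hdet A hA
    -- `D` has zero last row and column. Since `A 2 2 = 0`, the determinant of `A + D` is linear in
    -- the upper left block, so it yields a linear condition on `Y`.
    have hD := W.sub_mem (W.smul_mem (A i 2) hY) (W.smul_mem (Y i 2) hA)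
    have hAD := hdet _ (W.add_mem hA hD)
    have r : ∀ j, A i 2 * Y 2 j - Y i 2 * A 2 j = 0 := fun j =>
      sub_eq_zero.2 (hcross A hA Y hY i j)
    have c : ∀ k, A i 2 * Y k 2 - Y i 2 * A k 2 = 0 := fun k => by
      apply mul_right_cancel₀ hj
      linear_combination A i 2 * hcross Y hY A hA k j - A k 2 * hcross Y hY A hA i j
    have r0 := r 0
    have r1 := r 1
    have c0 := c 0
    have c1 := c 1
    simp [Matrix.det_fin_three, r0, r1, c0, c1, (hcoef Y hY).1, (hcoef A hA).1] at hAF hAD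
    apply mul_left_cancel₀ hi
    linear_combination hAD - (1 - Y i 2) * hAF
  refine HasSpan.of_compression (a := A 0 2) (b := A 1 2) ?_ (fun Y hY => (hcoef Y hY).1) f1 f2 ?_
  · by_cases h : A 0 2 = 0
    · exact Or.inr (hA' h)
    · exact Or.inl h
  · intro Y hY
    -- The last row of `A` is orthogonal to `(A 0 2, A 1 2)`, hence proportional to `(-A 1 2, A 0
    -- 2)`; this turns `hF` into the required equation.
    have h0 : A 2 1 * (A 0 2 * (Y 1 0 * A 0 2 + Y 1 1 * A 1 2)
        - A 1 2 * (Y 0 0 * A 0 2 + Y 0 1 * A 1 2)) = 0 := by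
      linear_combination A 0 2 * hF Y hY + (A 0 2 * Y 1 1 - A 1 2 * Y 0 1) * hAw
    have h1 : A 2 0 * (A 0 2 * (Y 1 0 * A 0 2 + Y 1 1 * A 1 2)
        - A 1 2 * (Y 0 0 * A 0 2 + Y 0 1 * A 1 2)) = 0 := by
      linear_combination -A 1 2 * hF Y hY + (A 0 2 * Y 1 0 - A 1 2 * Y 0 0) * hAw
    rcases mul_eq_zero.1 h0 with h | h
    · rcases mul_eq_zero.1 h1 with h' | h'
      · refine absurd ?_ hj
        fin_cases j
        · exact h'
        · exact h
        · exact (hcoef A hA).1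
      · exact h'
    · exact h

/-- The cases are the maximal rank in `W`: an invertible element gives commuting matrices, rank two
is normalised to `diag(1, 1, 0)`, and if all ranks are at most one then three generators suffice. -/
theorem IsStrassen.trichotomy {W : Submodule ℂ (Matrix (Fin 3) (Fin 3) ℂ)} (hS : IsStrassen W)
    (hd : Module.finrank ℂ W ≤ 3) :
    HasSpan 5 W ∨ (∃ p : Fin 3 → ℂ, p ≠ 0 ∧ ∀ X ∈ W, X *ᵥ p = 0) ∨
      (∃ q : Fin 3 → ℂ, q ≠ 0 ∧ ∀ X ∈ W, q ᵥ* X = 0) := by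
  by_cases hinv : ∃ Z ∈ W, IsUnit Z
  · obtain ⟨Z, hZ, hu⟩ := hinv
    have hu' := (Matrix.isUnit_iff_isUnit_det Z).1 hu
    left
    refine HasSpan.of_map (P := Z⁻¹) (Q := 1) ?_ isUnit_one ?_
    · rw [Matrix.isUnit_nonsing_inv_iff]; exact hu
    refine HasSpan.of_commute ((Submodule.finrank_map_le _ _).trans hd)
      ⟨Z, hZ, by simp [Matrix.nonsing_inv_mul Z hu']⟩ ?_
    rintro _ ⟨X, hX, rfl⟩ _ ⟨Y, hY, rfl⟩
    have h := congrArg (fun T => (Z.det)⁻¹ • (Z⁻¹ * T)) (hS X hX Y hY Z hZ)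
    have ha : Z.adjugate = Z.det • Z⁻¹ := by
      rw [Matrix.inv_def, smul_smul, Ring.mul_inverse_cancel _ hu', one_smul]
    simp only [ha, Matrix.mul_smul, Matrix.smul_mul, smul_smul, inv_mul_cancel₀ hu'.ne_zero,
      one_smul] at h
    simpa [Commute, SemiconjBy, Matrix.mul_assoc] using h
  push Not at hinv
  have hdet : ∀ X ∈ W, X.det = 0 := fun X hX => by
    by_contra h
    exact hinv X hX ((Matrix.isUnit_iff_isUnit_det X).2 (isUnit_iff_ne_zero.2 h))
  by_cases hM : ∃ M ∈ W, ¬ M.rank ≤ 1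
  · obtain ⟨M, hM, hr⟩ := hM
    have hr2 : M.rank = 2 := by
      have h3 : M.rank ≤ 3 := by simpa using M.rank_le_card_width
      have h3' : M.rank ≠ 3 := fun h => hinv M hM (by
        rw [← Matrix.linearIndependent_cols_iff_isUnit,
          linearIndependent_iff_card_eq_finrank_span, Set.finrank,
          ← Matrix.rank_eq_finrank_span_cols, h, Fintype.card_fin])
      omega
    obtain ⟨P, Q, hP, hQ, h⟩ := exists_mul_mul_eq_diagonal hr2
    have hP' := (Matrix.isUnit_iff_isUnit_det P).1 hP
    have hQ' := (Matrix.isUnit_iff_isUnit_det Q).1 hQ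
    have he : (Pi.single 2 1 : Fin 3 → ℂ) ≠ 0 := by simp
    have htri := trichotomy_of_diagonal_mem (W := W.map (mulLeftRight P Q)) ⟨M, hM, h⟩ (hS.map P Q) (by
      rintro _ ⟨X, hX, rfl⟩; simp [hdet X hX])
    generalize (Pi.single 2 1 : Fin 3 → ℂ) = e at he htri
    rcases htri with h | h | h
    · exact Or.inl (HasSpan.of_map hP hQ h)
    · refine Or.inr (Or.inl ⟨Q *ᵥ e, fun h0 => ?_, fun X hX => ?_⟩)
      · have := congrArg (fun v => Q⁻¹ *ᵥ v) h0
        simp [Matrix.nonsing_inv_mul Q hQ', he] at this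
      · have h1 := congrArg (fun v => P⁻¹ *ᵥ v) (h _ (Submodule.mem_map_of_mem hX))
        simpa [Matrix.nonsing_inv_mul_cancel_left _ _ hP', Matrix.mul_assoc] using h1
    · refine Or.inr (Or.inr ⟨e ᵥ* P, fun h0 => ?_, fun X hX => ?_⟩)
      · have := congrArg (fun v => v ᵥ* P⁻¹) h0
        simp [Matrix.mul_nonsing_inv P hP', he] at this
      · have h1 := congrArg (fun v => v ᵥ* Q⁻¹) (h _ (Submodule.mem_map_of_mem hX))
        simpa [Matrix.mul_nonsing_inv_cancel_right _ _ hQ'] using h1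
  · push Not at hM
    left
    obtain ⟨m, hm, hs⟩ := exists_le_span_of_finrank_le W hd
    choose u v huv using fun i => exists_vecMulVec_of_rank_le_one (hM (m i) (hm i))
    refine ⟨![u 0, u 1, u 2, 0, 0], ![v 0, v 1, v 2, 0, 0], hs.trans ?_⟩
    rw [Submodule.span_le]
    rintro _ ⟨i, rfl⟩
    refine Submodule.subset_span ?_
    fin_cases i
    · exact ⟨0, (huv 0).symm⟩
    · exact ⟨1, (huv 1).symm⟩
    · exact ⟨2, (huv 2).symm⟩

end SingularSpaces

/-! ### Rank of 3 × 3 × 3 arrays. -/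

section Arrays

open Matrix

/-- The three-way array `t` is a sum of `r` products of vectors. -/
def ArrayRankLE (r : ℕ) (t : Fin 3 → Fin 3 → Fin 3 → ℂ) : Prop :=
  ∃ u v w : Fin r → Fin 3 → ℂ, ∀ i j k, t i j k = ∑ l, u l i * v l j * w l k

theorem ArrayRankLE.of_hasSpan {r : ℕ} {t : Fin 3 → Fin 3 → Fin 3 → ℂ}
    {W : Submodule ℂ (Matrix (Fin 3) (Fin 3) ℂ)} (hW : HasSpan r W)
    (ht : ∀ k, Matrix.of (fun i j => t i j k) ∈ W) : ArrayRankLE r t := by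
  obtain ⟨u, v, h⟩ := hW
  choose c hc using fun k => (Submodule.mem_span_range_iff_exists_fun ℂ).1 (h (ht k))
  refine ⟨u, v, fun l k => c k l, fun i j k => ?_⟩
  have := congrFun (congrFun (hc k) i) j
  simp only [Matrix.sum_apply, Matrix.smul_apply, vecMulVec_apply, Matrix.of_apply,
    smul_eq_mul] at this
  rw [← this]
  exact Finset.sum_congr rfl fun l _ => by ring

/-- The orthogonal complement of `p` is a plane with basis `b, c`; its coordinates extend to the
functionals `f, g`. -/
theorem exists_coordinates_of_orthogonal {p : Fin 3 → ℂ} (hp : p ≠ 0) :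
    ∃ b c f g : Fin 3 → ℂ, ∀ x : Fin 3 → ℂ, x ⬝ᵥ p = 0 →
      ∀ j, x j = (x ⬝ᵥ f) * b j + (x ⬝ᵥ g) * c j := by
  obtain ⟨i, hi⟩ := Function.ne_iff.1 hp
  simp only [Pi.zero_apply] at hi
  simp only [dotProduct, Fin.sum_univ_three]
  fin_cases i <;> simp only [Fin.zero_eta, Fin.mk_one, Fin.reduceFinMk] at hi
  · refine ⟨![-p 1 / p 0, 1, 0], ![-p 2 / p 0, 0, 1], ![0, 1, 0], ![0, 0, 1], fun x hx j => ?_⟩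
    fin_cases j <;> simp
    field_simp
    linear_combination hx
  · refine ⟨![1, -p 0 / p 1, 0], ![0, -p 2 / p 1, 1], ![1, 0, 0], ![0, 0, 1], fun x hx j => ?_⟩
    fin_cases j <;> simp
    field_simp
    linear_combination hx
  · refine ⟨![1, 0, -p 0 / p 2], ![0, 1, -p 1 / p 2], ![1, 0, 0], ![0, 1, 0], fun x hx j => ?_⟩
    fin_cases j <;> simp
    field_simp
    linear_combination hx

/-- Such an array is essentially 3 × 2 × 2, so four terms suffice; the fifth is zero. -/
theorem ArrayRankLE.of_orthogonal_of_orthogonal {t : Fin 3 → Fin 3 → Fin 3 → ℂ} {p q : Fin 3 → ℂ}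
    (hp : p ≠ 0) (hq : q ≠ 0) (h1 : ∀ i k, (fun j => t i j k) ⬝ᵥ p = 0)
    (h2 : ∀ i j, (fun k => t i j k) ⬝ᵥ q = 0) : ArrayRankLE 5 t := by
  obtain ⟨b, c, f, g, hbc⟩ := exists_coordinates_of_orthogonal hp
  obtain ⟨b', c', f', g', hbc'⟩ := exists_coordinates_of_orthogonal hq
  refine ⟨![fun i => ∑ j, ∑ k, t i j k * f' k * f j, fun i => ∑ j, ∑ k, t i j k * g' k * f j,
    fun i => ∑ j, ∑ k, t i j k * f' k * g j, fun i => ∑ j, ∑ k, t i j k * g' k * g j, 0],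
    ![b, b, c, c, 0], ![b', c', b', c', 0], fun i j k => ?_⟩
  have e1 := hbc _ (h1 i k) j
  have e2 := fun j => hbc' _ (h2 i j) k
  simp only [dotProduct, Fin.sum_univ_three] at e1 e2
  rw [e1, e2 0, e2 1, e2 2]
  simp [Fin.sum_univ_five, Fin.sum_univ_three]
  ring

/-- The slices lie in a pencil, where Strassen's condition is automatic. A common kernel vector then
gives a second orthogonality relation. -/
theorem ArrayRankLE.of_orthogonal {t : Fin 3 → Fin 3 → Fin 3 → ℂ} {p : Fin 3 → ℂ}
    (hp : p ≠ 0) (h : ∀ i j, (fun k => t i j k) ⬝ᵥ p = 0) : ArrayRankLE 5 t := by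
  obtain ⟨b, c, f, g, hbc⟩ := exists_coordinates_of_orthogonal hp
  let E : Matrix (Fin 3) (Fin 3) ℂ := Matrix.of fun i j => (fun k => t i j k) ⬝ᵥ f
  let F : Matrix (Fin 3) (Fin 3) ℂ := Matrix.of fun i j => (fun k => t i j k) ⬝ᵥ g
  have ht : ∀ k, Matrix.of (fun i j => t i j k) ∈ Submodule.span ℂ {E, F} := fun k => by
    refine Submodule.mem_span_pair.2 ⟨b k, c k, ?_⟩
    ext i j
    simp only [E, F, Matrix.add_apply, Matrix.smul_apply, Matrix.of_apply, smul_eq_mul]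
    rw [hbc _ (h i j) k]
    ring
  have hd : Module.finrank ℂ (Submodule.span ℂ {E, F}) ≤ 3 :=
    (finrank_span_le_card _).trans (by
      rw [Set.toFinset_insert, Set.toFinset_singleton]
      exact Finset.card_le_two.trans (by norm_num))
  rcases (IsStrassen.span_pair E F).trichotomy hd with hs | ⟨q, hq, hs⟩ | ⟨q, hq, hs⟩
  · exact ArrayRankLE.of_hasSpan hs ht
  · exact ArrayRankLE.of_orthogonal_of_orthogonal hq hp
      (fun i k => congrFun (hs _ (ht k)) i) h
  · obtain ⟨u, v, w, huvw⟩ := ArrayRankLE.of_orthogonal_of_orthogonal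
      (t := fun j i k => t i j k) hq hp
      (fun j k => (dotProduct_comm _ _).trans (congrFun (hs _ (ht k)) j)) (fun i j => h j i)
    exact ⟨v, u, w, fun i j k => (huvw j i k).trans
      (Finset.sum_congr rfl fun l _ => by ring)⟩

/-- A `3 × 3 × 3` array satisfying Strassen's commutation condition has rank at most five. -/
theorem ArrayRankLE.of_isStrassen {t : Fin 3 → Fin 3 → Fin 3 → ℂ}
    (h : IsStrassen (Submodule.span ℂ (Set.range fun k => Matrix.of (fun i j => t i j k)))) :
    ArrayRankLE 5 t := by
  have ht : ∀ k, Matrix.of (fun i j => t i j k) ∈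
      Submodule.span ℂ (Set.range fun k => Matrix.of (fun i j => t i j k)) := fun k =>
    Submodule.subset_span ⟨k, rfl⟩
  rcases h.trichotomy ((finrank_range_le_card _).trans (by simp)) with
    hs | ⟨q, hq, hs⟩ | ⟨q, hq, hs⟩
  · exact ArrayRankLE.of_hasSpan hs ht
  · obtain ⟨u, v, w, huvw⟩ := ArrayRankLE.of_orthogonal (t := fun i k j => t i j k) hq
      (fun i k => congrFun (hs _ (ht k)) i)
    exact ⟨u, w, v, fun i j k => (huvw i k j).trans
      (Finset.sum_congr rfl fun l _ => by ring)⟩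
  · obtain ⟨u, v, w, huvw⟩ := ArrayRankLE.of_orthogonal (t := fun j k i => t i j k) hq
      (fun j k => (dotProduct_comm _ _).trans (congrFun (hs _ (ht k)) j))
    exact ⟨w, u, v, fun i j k => (huvw j k i).trans
      (Finset.sum_congr rfl fun l _ => by ring)⟩

end Arrays
-- Homogeneous forms and Zariski closure.
section Forms

variable {V : Type*} [AddCommGroup V] [Module ℂ V]

/-- The function `F` is the value of a homogeneous form of degree `d`. -/
def IsForm (d : ℕ) (F : V → ℂ) : Prop :=
  ∃ f : MvPolynomial (Module.Dual ℂ V) ℂ, f.IsHomogeneous d ∧ ∀ v, F v = formEval f v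

theorem isForm_dual (φ : Module.Dual ℂ V) : IsForm 1 (fun v => φ v) :=
  ⟨MvPolynomial.X φ, MvPolynomial.isHomogeneous_X ℂ φ, fun v => by simp [formEval]⟩

theorem IsForm.add {d : ℕ} {F G : V → ℂ} (hF : IsForm d F) (hG : IsForm d G) :
    IsForm d (fun v => F v + G v) := by
  obtain ⟨f, hf, hf'⟩ := hF
  obtain ⟨g, hg, hg'⟩ := hG
  exact ⟨f + g, hf.add hg, fun v => by simp [hf', hg', formEval]⟩

theorem IsForm.mul {d e : ℕ} {F G : V → ℂ} (hF : IsForm d F) (hG : IsForm e G) :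
    IsForm (d + e) (fun v => F v * G v) := by
  obtain ⟨f, hf, hf'⟩ := hF
  obtain ⟨g, hg, hg'⟩ := hG
  exact ⟨f * g, hf.mul hg, fun v => by simp [hf', hg', formEval]⟩

theorem IsForm.const_mul {d : ℕ} {F : V → ℂ} (hF : IsForm d F) (c : ℂ) :
    IsForm d (fun v => c * F v) := by
  obtain ⟨f, hf, hf'⟩ := hF
  exact ⟨MvPolynomial.C c * f, by simpa using (MvPolynomial.isHomogeneous_C _ c).mul hf,
    fun v => by simp [hf', formEval]⟩

theorem IsForm.neg {d : ℕ} {F : V → ℂ} (hF : IsForm d F) : IsForm d (fun v => -F v) := by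
  simpa using hF.const_mul (-1)

theorem IsForm.sub {d : ℕ} {F G : V → ℂ} (hF : IsForm d F) (hG : IsForm d G) :
    IsForm d (fun v => F v - G v) := by
  simpa [sub_eq_add_neg] using hF.add hG.neg

theorem isForm_sum {ι : Type*} (s : Finset ι) {d : ℕ} {F : ι → V → ℂ}
    (hF : ∀ i, IsForm d (F i)) : IsForm d (fun v => ∑ i ∈ s, F i v) := by
  choose f hf hf' using hF
  exact ⟨∑ i ∈ s, f i, MvPolynomial.IsHomogeneous.sum _ _ _ fun i _ => hf i,
    fun v => by simp [hf', formEval]⟩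

theorem isForm_prod {ι : Type*} (s : Finset ι) {F : ι → V → ℂ}
    (hF : ∀ i, IsForm 1 (F i)) : IsForm s.card (fun v => ∏ i ∈ s, F i v) := by
  choose f hf hf' using hF
  exact ⟨∏ i ∈ s, f i, by
    simpa using MvPolynomial.IsHomogeneous.prod s f (fun _ => 1) fun i _ => hf i,
    fun v => by simp [hf', formEval]⟩

theorem isForm_det {n : ℕ} (φ : Fin n → Fin n → Module.Dual ℂ V) :
    IsForm n (fun v => (Matrix.of fun i j => φ i j v).det) := by
  simp only [Matrix.det_apply']
  refine isForm_sum _ fun σ => IsForm.const_mul ?_ _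
  simpa using isForm_prod Finset.univ fun i => isForm_dual (φ (σ i) i)

theorem isForm_adjugate (φ : Fin 3 → Fin 3 → Module.Dual ℂ V) (i j : Fin 3) :
    IsForm 2 (fun v => (Matrix.of fun i j => φ i j v).adjugate i j) := by
  have h : ∀ a b c d : Module.Dual ℂ V, IsForm 2 (fun v => a v * b v - c v * d v) :=
    fun a b c d => ((isForm_dual a).mul (isForm_dual b)).sub ((isForm_dual c).mul (isForm_dual d))
  have h' : ∀ a b c d : Module.Dual ℂ V, IsForm 2 (fun v => -(a v * b v) + c v * d v) :=
    fun a b c d => ((isForm_dual a).mul (isForm_dual b)).neg.add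
      ((isForm_dual c).mul (isForm_dual d))
  fin_cases i <;> fin_cases j <;> simp [Matrix.adjugate_fin_three] <;>
    first | exact h _ _ _ _ | exact h' _ _ _ _

theorem isForm_mul_adjugate_mul (φ χ ψ : Fin 3 → Fin 3 → Module.Dual ℂ V) (i j : Fin 3) :
    IsForm 4 (fun v => ((Matrix.of fun i j => φ i j v) * (Matrix.of fun i j => χ i j v).adjugate *
      (Matrix.of fun i j => ψ i j v)) i j) := by
  simp only [Matrix.mul_apply]
  exact isForm_sum _ fun k => (isForm_sum _ fun l =>
    (isForm_dual (φ i l)).mul (isForm_adjugate χ l k)).mul (isForm_dual (ψ k j))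

theorem formEval_smul {d : ℕ} {f : MvPolynomial (Module.Dual ℂ V) ℂ} (hf : f.IsHomogeneous d)
    (c : ℂ) (v : V) : formEval f (c • v) = c ^ d * formEval f v := by
  rw [formEval, formEval, MvPolynomial.eval_eq, MvPolynomial.eval_eq, Finset.mul_sum]
  refine Finset.sum_congr rfl fun m hm => ?_
  have h := hf (MvPolynomial.mem_support_iff.1 hm)
  simp only [map_smul, smul_eq_mul, mul_pow, Finset.prod_mul_distrib]
  rw [Finset.prod_pow_eq_pow_sum]
  have : ∑ i ∈ m.support, m i = d := by
    rw [← h, Finsupp.weight_apply, Finsupp.sum]; simp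
  rw [this]; ring

theorem formEval_rep_mk_eq_zero_iff {d : ℕ} {f : MvPolynomial (Module.Dual ℂ V) ℂ}
    (hf : f.IsHomogeneous d) {v : V} (hv : v ≠ 0) :
    formEval f (Projectivization.mk ℂ v hv).rep = 0 ↔ formEval f v = 0 := by
  obtain ⟨a, ha⟩ := Projectivization.exists_smul_eq_mk_rep ℂ v hv
  rw [← ha, Units.smul_def, formEval_smul hf]
  simp

theorem IsForm.eq_zero_of_mem_zariskiClosure {d : ℕ} {F : V → ℂ} (hF : IsForm d F)
    {S : Set (Projectivization ℂ V)} (h : ∀ v hv, Projectivization.mk ℂ v hv ∈ S → F v = 0)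
    {v : V} (hv : v ≠ 0) (hvS : Projectivization.mk ℂ v hv ∈ zariskiClosure S) : F v = 0 := by
  obtain ⟨f, hf, hF⟩ := hF
  rw [hF, ← formEval_rep_mk_eq_zero_iff hf hv]
  refine hvS d f hf fun s hs => ?_
  rw [← hF]
  exact h s.rep s.rep_nonzero (by rwa [s.mk_rep])

/-- Forms are polynomials in finitely many functionals, so weak convergence is enough to pass to the
limit. -/
theorem mem_zariskiClosure_of_tendsto {S : Set (Projectivization ℂ V)} {v : V} (hv : v ≠ 0)
    {α : Type*} {l : Filter α} [l.NeBot] {w : α → V}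
    (hw : ∀ φ : Module.Dual ℂ V, Filter.Tendsto (fun t => φ (w t)) l (𝓝 (φ v)))
    (hS : ∀ᶠ t in l, ∀ h : w t ≠ 0, Projectivization.mk ℂ (w t) h ∈ S) :
    Projectivization.mk ℂ v hv ∈ zariskiClosure S := by
  intro d f hf hfS
  rw [formEval_rep_mk_eq_zero_iff hf]
  have hc : Filter.Tendsto (fun t => formEval f (w t)) l (𝓝 (formEval f v)) :=
    ((MvPolynomial.continuous_eval f).tendsto _).comp (tendsto_pi_nhds.2 hw)
  obtain ⟨φ, hφ⟩ : ∃ φ : Module.Dual ℂ V, φ v ≠ 0 := by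
    by_contra! h
    exact hv ((Module.forall_dual_apply_eq_zero_iff ℂ v).1 h)
  have h0 : ∀ᶠ t in l, formEval f (w t) = 0 := by
    filter_upwards [hS, (hw φ).eventually_ne hφ] with t ht hφt
    have hne : w t ≠ 0 := fun h => hφt (by rw [h, map_zero])
    have := hfS _ (ht hne)
    rwa [formEval_rep_mk_eq_zero_iff hf] at this
  exact tendsto_nhds_unique hc ((Filter.tendsto_congr' h0).2 tendsto_const_nhds)

end Forms

/-! ### Minors of flattenings. -/

section Flattening

variable {M N : Type*} [AddCommGroup M] [Module ℂ M] [AddCommGroup N] [Module ℂ N]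

open TensorProduct in
-- The matrix factors through `ℂ ^ r`.
theorem det_dualDistrib_sum_eq_zero {r : ℕ} (m : Fin r → M) (n : Fin r → N)
    (α : Fin (r + 1) → Module.Dual ℂ M) (ψ : Fin (r + 1) → Module.Dual ℂ N) :
    (Matrix.of fun i j => dualDistrib ℂ M N (α i ⊗ₜ ψ j) (∑ l, m l ⊗ₜ[ℂ] n l)).det = 0 := by
  have h : (Matrix.of fun i j => dualDistrib ℂ M N (α i ⊗ₜ ψ j) (∑ l, m l ⊗ₜ[ℂ] n l)) =
      (Matrix.of fun i l => α i (m l)) * (Matrix.of fun l j => ψ j (n l)) := by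
    ext i j
    simp [Matrix.mul_apply]
  rw [h]
  by_contra hd
  have h1 := Matrix.rank_of_isUnit _ ((Matrix.isUnit_iff_isUnit_det _).2 (isUnit_iff_ne_zero.2 hd))
  have h2 := (Matrix.rank_mul_le_left (Matrix.of fun i l => α i (m l))
    (Matrix.of fun l j => ψ j (n l))).trans (Matrix.rank_le_card_width _)
  simp at h1 h2
  omega

open TensorProduct in
theorem apply_rid_lTensor (α : Module.Dual ℂ M) (ψ : Module.Dual ℂ N) (T : M ⊗[ℂ] N) :
    α (TensorProduct.rid ℂ M (LinearMap.lTensor M ψ T)) = dualDistrib ℂ M N (α ⊗ₜ ψ) T := by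
  induction T with
  | zero => simp
  | tmul x y => simp [mul_comm]
  | add x y hx hy => simp only [map_add, hx, hy]

open TensorProduct in
/-- If all minors of size `r + 1` of a flattening vanish, the tensor is fixed by a map of rank at
most `r` acting on the first factor. -/
theorem exists_rTensor_eq_of_minors [FiniteDimensional ℂ N] {r : ℕ}
    (T : M ⊗[ℂ] N) (h : ∀ (α : Fin (r + 1) → Module.Dual ℂ M) (ψ : Fin (r + 1) → Module.Dual ℂ N),
      (Matrix.of fun i j => dualDistrib ℂ M N (α i ⊗ₜ ψ j) T).det = 0) :
    ∃ (m : Fin r → M) (α : Fin r → Module.Dual ℂ M),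
      map (∑ i, (α i).smulRight (m i)) LinearMap.id T = T := by
  let c : Module.Dual ℂ N →ₗ[ℂ] M :=
    { toFun := fun ψ => TensorProduct.rid ℂ M (LinearMap.lTensor M ψ T)
      map_add' := fun ψ χ => by rw [LinearMap.lTensor_add]; simp
      map_smul' := fun a ψ => by rw [LinearMap.lTensor_smul]; simp }
  have hc : ∀ (α : Module.Dual ℂ M) ψ, α (c ψ) = dualDistrib ℂ M N (α ⊗ₜ ψ) T := by
    exact fun α ψ => apply_rid_lTensor α ψ T
  -- If the contraction map `c` had larger rank, functionals dual to independent values of `c` would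
  -- give an identity minor.
  have hfin : Module.finrank ℂ c.range ≤ r := by
    by_contra! hlt
    let b := Module.finBasis ℂ c.range
    let x : Fin (r + 1) → c.range := fun i => b (Fin.castLE hlt i)
    have hx : LinearIndependent ℂ x := b.linearIndependent.comp _ (Fin.castLE_injective hlt)
    choose ψ hψ using fun i => (x i).2
    choose α hα using fun i => LinearMap.exists_extend (b.coord (Fin.castLE hlt i))
    have : (Matrix.of fun i j => dualDistrib ℂ M N (α i ⊗ₜ ψ j) T) = 1 := by
      ext i j
      have h2 := LinearMap.congr_fun (hα i) (x j)
      simp only [LinearMap.comp_apply, Submodule.subtype_apply] at h2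
      rw [Matrix.of_apply, ← hc, hψ, h2]
      simp [x, Finsupp.single_apply, Matrix.one_apply, eq_comm]
    have h1 := h α ψ
    rw [this, Matrix.det_one] at h1
    exact one_ne_zero h1
  obtain ⟨m, α, -, hm⟩ := exists_coordinates c.range hfin
  refine ⟨m, α, ?_⟩
  let b := Module.finBasis ℂ N
  -- `T` is rebuilt from its contractions, so a map fixing the range of `c` fixes `T`.
  have hT : T = ∑ j, c (b.coord j) ⊗ₜ[ℂ] b j := by
    simp only [c, LinearMap.coe_mk, AddHom.coe_mk]
    clear hm hfin hc h c
    induction T with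
    | zero => simp
    | tmul x y =>
      conv_lhs => rw [← b.sum_repr y, tmul_sum]
      simp [smul_tmul]
    | add x y hx hy =>
      conv_lhs => rw [hx, hy]
      simp [add_tmul, Finset.sum_add_distrib]
  conv_rhs => rw [hT]
  rw [hT, map_sum]
  refine Finset.sum_congr rfl fun j _ => ?_
  rw [map_tmul, LinearMap.id_apply]
  congr 1
  simpa using hm _ ⟨_, rfl⟩

end Flattening
-- Tensor rank, Strassen's equations and the upper bound.
section SegreRank

variable {A B C : Type*} [AddCommGroup A] [Module ℂ A] [AddCommGroup B] [Module ℂ B]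
  [AddCommGroup C] [Module ℂ C]

/-- The tensor `T` is a sum of `r` decomposable tensors. -/
def TensorRankLE (r : ℕ) (T : A ⊗[ℂ] B ⊗[ℂ] C) : Prop :=
  ∃ (a : Fin r → A) (b : Fin r → B) (c : Fin r → C), T = ∑ l, a l ⊗ₜ[ℂ] b l ⊗ₜ[ℂ] c l

theorem TensorRankLE.mono {r s : ℕ} (hrs : r ≤ s) {T : A ⊗[ℂ] B ⊗[ℂ] C}
    (h : TensorRankLE r T) : TensorRankLE s T := by
  obtain ⟨a, b, c, rfl⟩ := h
  obtain ⟨k, rfl⟩ := Nat.exists_eq_add_of_le hrs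
  exact ⟨Fin.append a 0, Fin.append b 0, Fin.append c 0, by simp [Fin.sum_univ_add]⟩

theorem rankLE_segre_iff {r : ℕ} {T : A ⊗[ℂ] B ⊗[ℂ] C} (hT : T ≠ 0) :
    RankLE (segre A B C) r (Projectivization.mk ℂ T hT) ↔ TensorRankLE r T := by
  constructor
  · rintro ⟨x, hx, hle⟩
    choose a b c h hx using hx
    have hmem : T ∈ Submodule.span ℂ (Set.range fun i => a i ⊗ₜ[ℂ] b i ⊗ₜ[ℂ] c i) := by
      rw [Submodule.span_range_eq_iSup]
      simp only [hx, Projectivization.submodule_mk] at hle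
      exact hle (Submodule.mem_span_singleton_self T)
    obtain ⟨d, hd⟩ := (Submodule.mem_span_range_iff_exists_fun ℂ).1 hmem
    exact ⟨fun i => d i • a i, b, c, by simp [← hd, TensorProduct.smul_tmul']⟩
  · rintro ⟨a, b, c, rfl⟩
    obtain ⟨i₀, -, hi₀⟩ := Finset.exists_ne_zero_of_sum_ne_zero hT
    -- A zero summand gives no projective point, so a fixed nonzero summand stands in for it.
    have key : ∀ i, ∃ x ∈ segre A B C, a i ⊗ₜ[ℂ] b i ⊗ₜ[ℂ] c i ∈ x.submodule := by
      intro i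
      by_cases hi : a i ⊗ₜ[ℂ] b i ⊗ₜ[ℂ] c i = 0
      · exact ⟨_, ⟨a i₀, b i₀, c i₀, hi₀, rfl⟩, by rw [hi]; exact zero_mem _⟩
      · refine ⟨_, ⟨a i, b i, c i, hi, rfl⟩, ?_⟩
        rw [Projectivization.submodule_mk]
        exact Submodule.mem_span_singleton_self _
    choose x hx hmem using key
    refine ⟨x, hx, ?_⟩
    rw [Projectivization.submodule_mk, Submodule.span_singleton_le_iff_mem]
    exact sum_mem fun i _ => Submodule.mem_iSup_of_mem i (hmem i)

theorem rank_segre_le_iff {r : ℕ} {T : A ⊗[ℂ] B ⊗[ℂ] C} (hT : T ≠ 0) :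
    rank (segre A B C) (Projectivization.mk ℂ T hT) ≤ r ↔ TensorRankLE r T := by
  constructor
  · intro h
    by_contra hcon
    have h1 : ((r + 1 : ℕ) : ℕ∞) ≤ rank (segre A B C) (Projectivization.mk ℂ T hT) := by
      refine le_iInf₂ fun s hs => ?_
      rw [Nat.cast_le]
      by_contra! hlt
      exact hcon (TensorRankLE.mono (Nat.lt_succ_iff.1 hlt) ((rankLE_segre_iff hT).1 hs))
    have h2 := h1.trans h
    rw [Nat.cast_le] at h2
    omega
  · intro h
    exact iInf₂_le r ((rankLE_segre_iff hT).2 h)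

theorem exists_eq_tmul_of_mem_affineCone {T : A ⊗[ℂ] B ⊗[ℂ] C}
    (hT : T ∈ affineCone (segre A B C)) : ∃ a b c, T = a ⊗ₜ[ℂ] b ⊗ₜ[ℂ] c := by
  by_cases h : T = 0
  · exact ⟨0, 0, 0, by simp [h]⟩
  · obtain ⟨a, b, c, h', he⟩ := hT h
    obtain ⟨d, hd⟩ := (Projectivization.mk_eq_mk_iff' ℂ _ _ h h').1 he
    exact ⟨d • a, b, c, by rw [← hd]; simp [TensorProduct.smul_tmul']⟩

theorem tmul_mem_affineCone (a : A) (b : B) (c : C) :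
    a ⊗ₜ[ℂ] b ⊗ₜ[ℂ] c ∈ affineCone (segre A B C) :=
  fun h => ⟨a, b, c, h, rfl⟩

/-- The linear form `a ⊗ b ⊗ c ↦ α a * β b * γ c`. -/
noncomputable def triForm (α : Module.Dual ℂ A) (β : Module.Dual ℂ B) (γ : Module.Dual ℂ C) :
    Module.Dual ℂ (A ⊗[ℂ] B ⊗[ℂ] C) :=
  TensorProduct.dualDistrib ℂ (A ⊗[ℂ] B) C (TensorProduct.dualDistrib ℂ A B (α ⊗ₜ β) ⊗ₜ γ)

@[simp] theorem triForm_tmul (α : Module.Dual ℂ A) (β : Module.Dual ℂ B) (γ : Module.Dual ℂ C)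
    (a : A) (b : B) (c : C) : triForm α β γ (a ⊗ₜ[ℂ] b ⊗ₜ[ℂ] c) = α a * β b * γ c := by
  simp [triForm]

theorem triForm_sum_smul (α : Module.Dual ℂ A) (β : Module.Dual ℂ B) {n : ℕ} (x : Fin n → ℂ)
    (γ : Fin n → Module.Dual ℂ C) :
    triForm α β (∑ k, x k • γ k) = ∑ k, x k • triForm α β (γ k) := by
  simp [triForm, TensorProduct.tmul_sum]

theorem eq_zero_of_forall_triForm_eq_zero [FiniteDimensional ℂ A] [FiniteDimensional ℂ B]
    [FiniteDimensional ℂ C] {T : A ⊗[ℂ] B ⊗[ℂ] C} (h : ∀ α β γ, triForm α β γ T = 0) : T = 0 := by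
  let bA := Module.finBasis ℂ A
  let bB := Module.finBasis ℂ B
  let bC := Module.finBasis ℂ C
  refine ((bA.tensorProduct bB).tensorProduct bC).ext_elem fun ⟨⟨i, j⟩, k⟩ => ?_
  have hc : ((bA.tensorProduct bB).tensorProduct bC).coord ((i, j), k) =
      triForm (bA.coord i) (bB.coord j) (bC.coord k) := by
    ext x y z
    simp [mul_comm]
  rw [map_zero, Finsupp.zero_apply, ← h (bA.coord i) (bB.coord j) (bC.coord k), ← hc,
    Module.Basis.coord_apply]

section Closure

variable {M N : Type*} [AddCommGroup M] [Module ℂ M] [AddCommGroup N] [Module ℂ N]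
  [FiniteDimensional ℂ N]

theorem exists_rTensor_eq_of_mem_secantVariety {r : ℕ} (e : A ⊗[ℂ] B ⊗[ℂ] C →ₗ[ℂ] M ⊗[ℂ] N)
    (he : ∀ a b c, ∃ m n, e (a ⊗ₜ b ⊗ₜ c) = m ⊗ₜ n) {T : A ⊗[ℂ] B ⊗[ℂ] C} (hT : T ≠ 0)
    (h : Projectivization.mk ℂ T hT ∈ secantVariety r (segre A B C)) :
    ∃ (m : Fin r → M) (α : Fin r → Module.Dual ℂ M),
      TensorProduct.map (∑ i, (α i).smulRight (m i)) LinearMap.id (e T) = e T := by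
  refine exists_rTensor_eq_of_minors _ fun α ψ => ?_
  refine (isForm_det fun i j => (TensorProduct.dualDistrib ℂ M N (α i ⊗ₜ ψ j)) ∘ₗ e
    ).eq_zero_of_mem_zariskiClosure (fun v hv hvS => ?_) hT h
  obtain ⟨a, b, c, rfl⟩ := (rank_segre_le_iff hv).1 hvS
  choose m n hmn using fun l => he (a l) (b l) (c l)
  have := det_dualDistrib_sum_eq_zero m n α ψ
  simpa only [LinearMap.comp_apply, map_sum, hmn] using this

end Closure

open TensorProduct in
theorem exists_map_first_eq_of_mem_secantVariety [FiniteDimensional ℂ B]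
    [FiniteDimensional ℂ C] {r : ℕ} {T : A ⊗[ℂ] B ⊗[ℂ] C} (hT : T ≠ 0)
    (h : Projectivization.mk ℂ T hT ∈ secantVariety r (segre A B C)) :
    ∃ (m : Fin r → A) (α : Fin r → Module.Dual ℂ A),
      map (map (∑ i, (α i).smulRight (m i)) LinearMap.id) LinearMap.id T = T := by
  let e := TensorProduct.assoc ℂ A B C
  obtain ⟨m, α, hm⟩ := exists_rTensor_eq_of_mem_secantVariety e.toLinearMap
    (fun a b c => ⟨a, b ⊗ₜ c, rfl⟩) hT h
  refine ⟨m, α, e.injective ?_⟩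
  refine Eq.trans ?_ hm
  generalize (∑ i, (α i).smulRight (m i)) = π
  have : e.toLinearMap ∘ₗ (map (map π LinearMap.id) LinearMap.id) =
      map π LinearMap.id ∘ₗ e.toLinearMap := by
    ext a b c; simp [e]
  exact LinearMap.congr_fun this T

open TensorProduct in
theorem exists_map_second_eq_of_mem_secantVariety [FiniteDimensional ℂ A]
    [FiniteDimensional ℂ C] {r : ℕ} {T : A ⊗[ℂ] B ⊗[ℂ] C} (hT : T ≠ 0)
    (h : Projectivization.mk ℂ T hT ∈ secantVariety r (segre A B C)) :
    ∃ (m : Fin r → B) (α : Fin r → Module.Dual ℂ B),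
      map (map LinearMap.id (∑ i, (α i).smulRight (m i))) LinearMap.id T = T := by
  let e := (TensorProduct.congr (TensorProduct.comm ℂ A B) (LinearEquiv.refl ℂ C)).trans
    (TensorProduct.assoc ℂ B A C)
  obtain ⟨m, α, hm⟩ := exists_rTensor_eq_of_mem_secantVariety e.toLinearMap
    (fun a b c => ⟨b, a ⊗ₜ c, by simp [e]⟩) hT h
  refine ⟨m, α, e.injective ?_⟩
  refine Eq.trans ?_ hm
  generalize (∑ i, (α i).smulRight (m i)) = π
  have : e.toLinearMap ∘ₗ (map (map LinearMap.id π) LinearMap.id) =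
      map π LinearMap.id ∘ₗ e.toLinearMap := by
    ext a b c; simp [e]
  exact LinearMap.congr_fun this T

open TensorProduct in
theorem exists_map_third_eq_of_mem_secantVariety [FiniteDimensional ℂ A]
    [FiniteDimensional ℂ B] {r : ℕ} {T : A ⊗[ℂ] B ⊗[ℂ] C} (hT : T ≠ 0)
    (h : Projectivization.mk ℂ T hT ∈ secantVariety r (segre A B C)) :
    ∃ (m : Fin r → C) (α : Fin r → Module.Dual ℂ C),
      map (LinearMap.id : A ⊗[ℂ] B →ₗ[ℂ] A ⊗[ℂ] B) (∑ i, (α i).smulRight (m i)) T = T := by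
  let e := TensorProduct.comm ℂ (A ⊗[ℂ] B) C
  obtain ⟨m, α, hm⟩ := exists_rTensor_eq_of_mem_secantVariety e.toLinearMap
    (fun a b c => ⟨c, a ⊗ₜ b, rfl⟩) hT h
  refine ⟨m, α, e.injective ?_⟩
  refine Eq.trans ?_ hm
  generalize (∑ i, (α i).smulRight (m i)) = π
  have : e.toLinearMap ∘ₗ (map LinearMap.id π) = map π LinearMap.id ∘ₗ e.toLinearMap := by
    ext a b c; simp [e]
  exact LinearMap.congr_fun this T

/-- For a sum of three decomposable tensors, every slice is `P * diagonal * Q` with the same `P, Q`,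
and diagonal matrices commute. The entries of the identity are forms of degree four, so it extends
to the closure. -/
theorem strassen_of_mem_secantVariety {T : A ⊗[ℂ] B ⊗[ℂ] C} (hT : T ≠ 0)
    (h : Projectivization.mk ℂ T hT ∈ secantVariety 3 (segre A B C))
    (α : Fin 3 → Module.Dual ℂ A) (β : Fin 3 → Module.Dual ℂ B) (γ₁ γ₂ γ₃ : Module.Dual ℂ C) :
    (Matrix.of fun i j => triForm (α i) (β j) γ₁ T) *
      (Matrix.of fun i j => triForm (α i) (β j) γ₃ T).adjugate *
      (Matrix.of fun i j => triForm (α i) (β j) γ₂ T) =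
    (Matrix.of fun i j => triForm (α i) (β j) γ₂ T) *
      (Matrix.of fun i j => triForm (α i) (β j) γ₃ T).adjugate *
      (Matrix.of fun i j => triForm (α i) (β j) γ₁ T) := by
  ext i₀ j₀
  rw [← sub_eq_zero]
  refine ((isForm_mul_adjugate_mul (fun i j => triForm (α i) (β j) γ₁)
    (fun i j => triForm (α i) (β j) γ₃) (fun i j => triForm (α i) (β j) γ₂) i₀ j₀).sub
    (isForm_mul_adjugate_mul (fun i j => triForm (α i) (β j) γ₂)
    (fun i j => triForm (α i) (β j) γ₃) (fun i j => triForm (α i) (β j) γ₁) i₀ j₀)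
    ).eq_zero_of_mem_zariskiClosure (fun v hv hvS => ?_) hT h
  obtain ⟨a, b, c, rfl⟩ := (rank_segre_le_iff hv).1 hvS
  rw [sub_eq_zero]
  let P : Matrix (Fin 3) (Fin 3) ℂ := Matrix.of fun i l => α i (a l)
  let Q : Matrix (Fin 3) (Fin 3) ℂ := Matrix.of fun l j => β j (b l)
  have hfac : ∀ γ : Module.Dual ℂ C,
      (Matrix.of fun i j => triForm (α i) (β j) γ (∑ l, a l ⊗ₜ[ℂ] b l ⊗ₜ[ℂ] c l)) =
        P * Matrix.diagonal (fun l => γ (c l)) * Q := by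
    intro γ
    ext i j
    rw [Matrix.mul_apply]
    simp only [Matrix.mul_diagonal, Matrix.of_apply, map_sum, triForm_tmul, P, Q]
    exact Finset.sum_congr rfl fun l _ => by ring
  have hdiag : ∀ γ γ' : Module.Dual ℂ C, P * Matrix.diagonal (fun l => γ (c l)) * Q *
      (P * Matrix.diagonal (fun l => γ₃ (c l)) * Q).adjugate *
      (P * Matrix.diagonal (fun l => γ' (c l)) * Q) =
      (Q.det * P.det) • (P * (Matrix.diagonal (fun l => γ (c l)) *
        (Matrix.diagonal (fun l => γ₃ (c l))).adjugate * Matrix.diagonal (fun l => γ' (c l))) *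
          Q) := by
    intro γ γ'
    rw [Matrix.adjugate_mul_distrib, Matrix.adjugate_mul_distrib]
    calc _ = P * Matrix.diagonal (fun l => γ (c l)) * (Q * Q.adjugate) *
          (Matrix.diagonal (fun l => γ₃ (c l))).adjugate * (P.adjugate * P) *
            Matrix.diagonal (fun l => γ' (c l)) * Q := by
          simp only [Matrix.mul_assoc]
      _ = _ := by
          rw [Matrix.mul_adjugate, Matrix.adjugate_mul]
          simp only [Matrix.mul_assoc, Matrix.smul_mul, Matrix.mul_smul, smul_smul, Matrix.mul_one]
          rw [mul_comm]
  rw [hfac, hfac, hfac, hdiag, hdiag, Matrix.adjugate_diagonal]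
  simp only [Matrix.diagonal_mul_diagonal]
  refine congrArg (fun d : Fin 3 → ℂ =>
    ((Q.det * P.det) • (P * Matrix.diagonal d * Q) : Matrix (Fin 3) (Fin 3) ℂ) i₀ j₀)
    (funext fun l => ?_)
  ring

open TensorProduct in
theorem sum_smul_tmul_sum_smul {n : ℕ} (x y z : Fin n → ℂ) (a : Fin n → A) (b : Fin n → B)
    (c : Fin n → C) :
    (∑ i, x i • a i) ⊗ₜ[ℂ] (∑ j, y j • b j) ⊗ₜ[ℂ] (∑ k, z k • c k) =
      ∑ i, ∑ j, ∑ k, (x i * y j * z k) • (a i ⊗ₜ[ℂ] b j ⊗ₜ[ℂ] c k) := by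
  rw [sum_tmul, sum_tmul]
  refine Finset.sum_congr rfl fun i _ => ?_
  rw [tmul_sum (x i • a i), sum_tmul]
  refine Finset.sum_congr rfl fun j _ => ?_
  rw [tmul_sum]
  refine Finset.sum_congr rfl fun k _ => ?_
  rw [tmul_smul, tmul_smul, ← smul_tmul', ← smul_tmul', ← smul_tmul', smul_smul, smul_smul]
  congr 1
  ring

open TensorProduct in
/-- Every tensor in the third secant variety is a sum of five decomposable tensors. -/
theorem tensorRankLE_five_of_mem_secantVariety [FiniteDimensional ℂ A]
    [FiniteDimensional ℂ B] [FiniteDimensional ℂ C] {T : A ⊗[ℂ] B ⊗[ℂ] C} (hT : T ≠ 0)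
    (h : Projectivization.mk ℂ T hT ∈ secantVariety 3 (segre A B C)) : TensorRankLE 5 T := by
  obtain ⟨a, α, hA⟩ := exists_map_first_eq_of_mem_secantVariety hT h
  obtain ⟨b, β, hB⟩ := exists_map_second_eq_of_mem_secantVariety hT h
  obtain ⟨c, γ, hC⟩ := exists_map_third_eq_of_mem_secantVariety hT h
  let t : Fin 3 → Fin 3 → Fin 3 → ℂ := fun i j k => triForm (α i) (β j) (γ k) T
  -- Composing the three maps that fix `T` writes it through the array `t`. The vectors `a i`, `b
  -- j`, `c k` need not be independent.
  have hexp : ∀ S : A ⊗[ℂ] B ⊗[ℂ] C,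
      map (map (∑ i, (α i).smulRight (a i)) LinearMap.id) LinearMap.id
        (map (map LinearMap.id (∑ i, (β i).smulRight (b i))) LinearMap.id
          (map LinearMap.id (∑ i, (γ i).smulRight (c i)) S)) =
      ∑ i, ∑ j, ∑ k, triForm (α i) (β j) (γ k) S • (a i ⊗ₜ[ℂ] b j ⊗ₜ[ℂ] c k) := by
    intro S
    have : map (map (∑ i, (α i).smulRight (a i)) LinearMap.id) LinearMap.id ∘ₗ
        (map (map LinearMap.id (∑ i, (β i).smulRight (b i))) LinearMap.id) ∘ₗ
          (map LinearMap.id (∑ i, (γ i).smulRight (c i))) =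
      ∑ i, ∑ j, ∑ k, (triForm (α i) (β j) (γ k)).smulRight (a i ⊗ₜ[ℂ] b j ⊗ₜ[ℂ] c k) := by
      ext x y z
      have := sum_smul_tmul_sum_smul (fun i => α i x) (fun j => β j y) (fun k => γ k z) a b c
      simpa [LinearMap.sum_apply] using this
    simpa [LinearMap.sum_apply] using LinearMap.congr_fun this S
  have hTt : T = ∑ i, ∑ j, ∑ k, t i j k • (a i ⊗ₜ[ℂ] b j ⊗ₜ[ℂ] c k) := by
    rw [← hexp, hC, hB, hA]
  have hS : IsStrassen (Submodule.span ℂ (Set.range fun k => Matrix.of (fun i j => t i j k))) := by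
    have key : ∀ X ∈ Submodule.span ℂ (Set.range fun k => Matrix.of (fun i j => t i j k)),
        ∃ γ' : Module.Dual ℂ C, X = Matrix.of fun i j => triForm (α i) (β j) γ' T := by
      intro X hX
      obtain ⟨x, hx⟩ := (Submodule.mem_span_range_iff_exists_fun ℂ).1 hX
      refine ⟨∑ k, x k • γ k, ?_⟩
      rw [← hx]
      ext i j
      simp [Matrix.sum_apply, triForm_sum_smul, t, LinearMap.sum_apply]
    intro X hX Y hY Z hZ
    obtain ⟨γ₁, rfl⟩ := key X hX
    obtain ⟨γ₂, rfl⟩ := key Y hY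
    obtain ⟨γ₃, rfl⟩ := key Z hZ
    exact strassen_of_mem_secantVariety hT h α β γ₁ γ₂ γ₃
  obtain ⟨u, v, w, huvw⟩ := ArrayRankLE.of_isStrassen hS
  refine ⟨fun l => ∑ i, u l i • a i, fun l => ∑ j, v l j • b j, fun l => ∑ k, w l k • c k, ?_⟩
  simp only [sum_smul_tmul_sum_smul]
  rw [hTt]
  symm
  rw [Finset.sum_comm]
  refine Finset.sum_congr rfl fun i _ => ?_
  rw [Finset.sum_comm]
  refine Finset.sum_congr rfl fun j _ => ?_
  rw [Finset.sum_comm]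
  refine Finset.sum_congr rfl fun k _ => ?_
  rw [huvw, Finset.sum_smul]

end SegreRank
-- The lower bound by substitution.
section LowerBound

variable {A B C : Type*} [AddCommGroup A] [Module ℂ A] [AddCommGroup B] [Module ℂ B]
  [AddCommGroup C] [Module ℂ C]

/-- The second derivative at `0` of `a(t) ⊗ b(t) ⊗ c(t)`, when `x`, `y`, `z` list the values and
the first two derivatives of `a`, `b`, `c`. -/
noncomputable def osculatingTensor (x : Fin 3 → A) (y : Fin 3 → B) (z : Fin 3 → C) :
    A ⊗[ℂ] B ⊗[ℂ] C :=
  x 2 ⊗ₜ y 0 ⊗ₜ z 0 + x 0 ⊗ₜ y 2 ⊗ₜ z 0 + x 0 ⊗ₜ y 0 ⊗ₜ z 2 +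
    (2 : ℂ) • (x 1 ⊗ₜ y 1 ⊗ₜ z 0 + x 1 ⊗ₜ y 0 ⊗ₜ z 1 + x 0 ⊗ₜ y 1 ⊗ₜ z 1)

theorem triForm_osculatingTensor (α : Module.Dual ℂ A) (β : Module.Dual ℂ B)
    (γ : Module.Dual ℂ C) (x : Fin 3 → A) (y : Fin 3 → B) (z : Fin 3 → C) :
    triForm α β γ (osculatingTensor x y z) =
      α (x 2) * β (y 0) * γ (z 0) + α (x 0) * β (y 2) * γ (z 0) + α (x 0) * β (y 0) * γ (z 2) +
      2 * (α (x 1) * β (y 1) * γ (z 0) + α (x 1) * β (y 0) * γ (z 1) +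
        α (x 0) * β (y 1) * γ (z 1)) := by
  simp [osculatingTensor, mul_add]

theorem exists_dual_family {n : ℕ} {x : Fin n → A} (hx : LinearIndependent ℂ x) :
    ∃ ξ : Fin n → Module.Dual ℂ A, ∀ i j, ξ i (x j) = if i = j then 1 else 0 := by
  let b := Module.Basis.span hx
  have hb : ∀ j, (b j : A) = x j := fun j => by
    simp only [b, Module.Basis.span_apply]
  choose ξ hξ using fun i => LinearMap.exists_extend (b.coord i)
  refine ⟨ξ, fun i j => ?_⟩
  have h := LinearMap.congr_fun (hξ i) (b j)
  rw [LinearMap.comp_apply, Submodule.subtype_apply, hb] at h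
  rw [h, Module.Basis.coord_apply, b.repr_self_apply]
  simp only [eq_comm]

/-- The substitution method. -/
theorem not_tensorRankLE_four_osculatingTensor {x : Fin 3 → A} {y : Fin 3 → B} {z : Fin 3 → C}
    (hx : LinearIndependent ℂ x) (hy : LinearIndependent ℂ y) (hz : LinearIndependent ℂ z) :
    ¬ TensorRankLE 4 (osculatingTensor x y z) := by
  rintro ⟨a, b, c, hT⟩
  obtain ⟨ξ, hξ⟩ := exists_dual_family hx
  obtain ⟨η, hη⟩ := exists_dual_family hy
  obtain ⟨ζ, hζ⟩ := exists_dual_family hz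
  have hval : ∀ α β γ, triForm α β γ (osculatingTensor x y z) =
      ∑ l, α (a l) * β (b l) * γ (c l) := fun α β γ => by simp [hT]
  -- Otherwise the values of `ξ 1` and `ξ 2` on the `a l` are proportional, those of `ξ 1` not all
  -- zero. Then the `ξ 2` slice would be a multiple of the `ξ 1` slice, but at `(η 0, ζ 0)` the
  -- former is 1 and the latter 0.
  have hminor : ∃ l l', ξ 1 (a l) * ξ 2 (a l') - ξ 1 (a l') * ξ 2 (a l) ≠ 0 := by
    by_contra! h
    have h11 := hval (ξ 1) (η 1) (ζ 0)
    have h10 := hval (ξ 1) (η 0) (ζ 0)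
    have h20 := hval (ξ 2) (η 0) (ζ 0)
    simp [triForm_osculatingTensor, hξ, hη, hζ] at h11 h10 h20
    obtain ⟨l, hl⟩ : ∃ l, ξ 1 (a l) ≠ 0 := by
      by_contra! h0
      simp [h0] at h11
    have : ξ 1 (a l) * ∑ m, ξ 2 (a m) * η 0 (b m) * ζ 0 (c m) =
        ξ 2 (a l) * ∑ m, ξ 1 (a m) * η 0 (b m) * ζ 0 (c m) := by
      rw [Finset.mul_sum, Finset.mul_sum]
      exact Finset.sum_congr rfl fun m _ => by
        linear_combination (η 0 (b m) * ζ 0 (c m)) * h l m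
    rw [← h20, ← h10] at this
    simp at this
    exact hl this
  obtain ⟨l, l', hll⟩ := hminor
  have hne : l ≠ l' := by rintro rfl; simp at hll
  let D := ξ 1 (a l) * ξ 2 (a l') - ξ 1 (a l') * ξ 2 (a l)
  -- Cramer's rule: `α` kills `a l` and `a l'` while keeping the value 1 on `x 0`.
  let α : Module.Dual ℂ A := ξ 0 + ((ξ 2 (a l) * ξ 0 (a l') - ξ 2 (a l') * ξ 0 (a l)) / D) • ξ 1 +
    ((ξ 1 (a l') * ξ 0 (a l) - ξ 1 (a l) * ξ 0 (a l')) / D) • ξ 2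
  have hD : D ≠ 0 := hll
  have hα0 : α (x 0) = 1 := by simp [α, hξ]
  have hαl : α (a l) = 0 := by
    simp only [α, LinearMap.add_apply, LinearMap.smul_apply, smul_eq_mul]
    field_simp
    simp only [D]
    ring
  have hαl' : α (a l') = 0 := by
    simp only [α, LinearMap.add_apply, LinearMap.smul_apply, smul_eq_mul]
    field_simp
    simp only [D]
    ring
  let G : Matrix (Fin 3) (Fin 3) ℂ :=
    Matrix.of fun j k => triForm α (η j) (ζ k) (osculatingTensor x y z)
  have hG : G.det = -2 := by
    simp [G, Matrix.det_fin_three, triForm_osculatingTensor, hη, hζ, hα0]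
  have hfac : G = (Matrix.of fun j l => η j (b l)) * Matrix.diagonal (fun l => α (a l)) *
      (Matrix.of fun l k => ζ k (c l)) := by
    ext j k
    rw [Matrix.mul_apply]
    simp only [G, Matrix.mul_diagonal, Matrix.of_apply, hval]
    exact Finset.sum_congr rfl fun l _ => by ring
  have h1 : G.rank = 3 := by
    have := Matrix.rank_of_isUnit G ((Matrix.isUnit_iff_isUnit_det _).2 (by rw [hG]; simp))
    simpa using this
  have h2 : G.rank ≤ 2 := by
    rw [hfac]
    refine (Matrix.rank_mul_le_left _ _).trans ((Matrix.rank_mul_le_right _ _).trans ?_)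
    classical
    rw [Matrix.rank_diagonal, Fintype.card_subtype]
    have hsub : (Finset.univ.filter fun i => α (a i) ≠ 0) ⊆ Finset.univ \ {l, l'} := by
      intro i hi
      simp only [Finset.mem_filter, Finset.mem_univ, true_and] at hi
      simp only [Finset.mem_sdiff, Finset.mem_univ, true_and, Finset.mem_insert,
        Finset.mem_singleton, not_or]
      exact ⟨fun h => hi (h ▸ hαl), fun h => hi (h ▸ hαl')⟩
    refine (Finset.card_le_card hsub).trans ?_
    rw [Finset.card_sdiff_of_subset (Finset.subset_univ _), Finset.card_pair hne]
    simp
  omega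

end LowerBound

/-! ### Second-order Taylor expansions. -/

section Jets

/-- The second-order Taylor expansion of `g` at `0` is `g₀ + g₁ t + g₂ t²`. -/
def HasJet (g : ℂ → ℂ) (g₀ g₁ g₂ : ℂ) : Prop :=
  ∃ m : ℂ → ℂ, ContinuousAt m 0 ∧ m 0 = g₂ ∧ ∀ᶠ t in 𝓝 (0 : ℂ), g t = g₀ + g₁ * t + m t * t ^ 2

theorem hasJet_of_analyticAt {g : ℂ → ℂ} (hg : AnalyticAt ℂ g 0) :
    HasJet g (g 0) (deriv g 0) (iteratedDeriv 2 g 0 / 2) := by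
  have h0 := hg.hasFPowerSeriesAt
  have h1 := h0.has_fpower_series_dslope_fslope
  have h2 := h1.has_fpower_series_dslope_fslope
  refine ⟨dslope (dslope g 0) 0, h2.analyticAt.continuousAt, ?_, Filter.Eventually.of_forall ?_⟩
  · rw [dslope_same, h1.deriv]
    simp
  · intro t
    have e1 := sub_smul_dslope g 0 t
    have e2 := sub_smul_dslope (dslope g 0) 0 t
    rw [dslope_same] at e2
    simp only [sub_zero, smul_eq_mul] at e1 e2
    linear_combination -e1 - t * e2

theorem HasJet.mul {f g : ℂ → ℂ} {f₀ f₁ f₂ g₀ g₁ g₂ : ℂ} (hf : HasJet f f₀ f₁ f₂)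
    (hg : HasJet g g₀ g₁ g₂) :
    HasJet (fun t => f t * g t) (f₀ * g₀) (f₀ * g₁ + f₁ * g₀) (f₀ * g₂ + f₁ * g₁ + f₂ * g₀) := by
  obtain ⟨m, hm, rfl, hf⟩ := hf
  obtain ⟨n, hn, rfl, hg⟩ := hg
  refine ⟨fun t => f₀ * n t + f₁ * g₁ + m t * g₀ + (f₁ * n t + m t * g₁) * t + m t * n t * t ^ 2,
    by fun_prop, by simp, ?_⟩
  filter_upwards [hf, hg] with t h1 h2
  rw [h1, h2]
  ring

theorem HasJet.congr {f g : ℂ → ℂ} {g₀ g₁ g₂ : ℂ} (hg : HasJet g g₀ g₁ g₂)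
    (h : ∀ᶠ t in 𝓝 (0 : ℂ), f t = g t) : HasJet f g₀ g₁ g₂ := by
  obtain ⟨m, hm, hm', hg⟩ := hg
  refine ⟨m, hm, hm', ?_⟩
  filter_upwards [hg, h] with t h1 h2
  rw [h2, h1]

theorem HasJet.unique {g : ℂ → ℂ} {f₀ f₁ f₂ g₀ g₁ g₂ : ℂ} (hf : HasJet g f₀ f₁ f₂)
    (hg : HasJet g g₀ g₁ g₂) : f₀ = g₀ ∧ f₁ = g₁ ∧ f₂ = g₂ := by
  obtain ⟨m, hm, rfl, hf⟩ := hf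
  obtain ⟨n, hn, rfl, hg⟩ := hg
  have e0 : f₀ = g₀ := by
    have h1 := hf.self_of_nhds
    have h2 := hg.self_of_nhds
    simp at h1 h2
    rw [← h1, h2]
  subst e0
  have hne : ∀ᶠ t in 𝓝[≠] (0 : ℂ), t ≠ 0 := eventually_mem_nhdsWithin
  have e1 : f₁ = g₁ := by
    have hc : Filter.Tendsto (fun t => f₁ + m t * t - n t * t) (𝓝[≠] (0 : ℂ)) (𝓝 f₁) := by
      have : ContinuousAt (fun t => f₁ + m t * t - n t * t) 0 := by fun_prop
      simpa using this.tendsto.mono_left nhdsWithin_le_nhds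
    refine tendsto_nhds_unique hc ((Filter.tendsto_congr' ?_).2 tendsto_const_nhds)
    filter_upwards [hf.filter_mono nhdsWithin_le_nhds, hg.filter_mono nhdsWithin_le_nhds, hne]
      with t h1 h2 ht
    apply mul_left_cancel₀ ht
    linear_combination h2 - h1
  subst e1
  refine ⟨rfl, rfl, tendsto_nhds_unique (hm.tendsto.mono_left nhdsWithin_le_nhds)
    ((Filter.tendsto_congr' ?_).2 (hn.tendsto.mono_left (nhdsWithin_le_nhds (s := {0}ᶜ))))⟩
  filter_upwards [hf.filter_mono nhdsWithin_le_nhds, hg.filter_mono nhdsWithin_le_nhds, hne]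
    with t h1 h2 ht
  apply mul_right_cancel₀ (pow_ne_zero 2 ht)
  linear_combination h2 - h1

/-- The expression is `g₀ + (g t - g (-t)) / (2t) + (g t - 2 g₀ + g (-t)) / t²`: central differences
for the first two derivatives. -/
theorem HasJet.tendsto {g : ℂ → ℂ} {g₀ g₁ g₂ : ℂ} (hg : HasJet g g₀ g₁ g₂) :
    Filter.Tendsto (fun t => (1 - 2 / t ^ 2) * g₀ + (1 / (2 * t) + 1 / t ^ 2) * g t +
      (1 / t ^ 2 - 1 / (2 * t)) * g (-t)) (𝓝[≠] (0 : ℂ)) (𝓝 (g₀ + g₁ + 2 * g₂)) := by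
  obtain ⟨m, hm, rfl, hg⟩ := hg
  have hneg : Filter.Tendsto (fun t : ℂ => -t) (𝓝 0) (𝓝 0) := by
    simpa using (continuous_neg (G := ℂ)).tendsto 0
  have hm' : ContinuousAt (fun t => m (-t)) 0 :=
    ContinuousAt.comp (f := fun t : ℂ => -t) (by simpa using hm) continuous_neg.continuousAt
  have hc : Filter.Tendsto (fun t => g₀ + (g₁ + (m t - m (-t)) * t * 2⁻¹) + (m t + m (-t)))
      (𝓝[≠] (0 : ℂ)) (𝓝 (g₀ + g₁ + 2 * m 0)) := by
    have : ContinuousAt (fun t => g₀ + (g₁ + (m t - m (-t)) * t * 2⁻¹) + (m t + m (-t))) 0 :=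
      (continuousAt_const.add (continuousAt_const.add
        (((hm.sub hm').mul continuousAt_id).mul continuousAt_const))).add (hm.add hm')
    simpa [two_mul] using this.tendsto.mono_left nhdsWithin_le_nhds
  refine (Filter.tendsto_congr' ?_).2 hc
  filter_upwards [hg.filter_mono nhdsWithin_le_nhds,
    (hneg.eventually hg).filter_mono nhdsWithin_le_nhds,
    (eventually_mem_nhdsWithin : ∀ᶠ t in 𝓝[≠] (0 : ℂ), t ≠ 0)] with t h1 h2 ht
  replace ht : t ≠ 0 := ht
  rw [h1, h2]
  field_simp
  ring

end Jets
-- Second-order points of curves on the cone.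
section SecondOrder

variable {A B C : Type*} [AddCommGroup A] [Module ℂ A] [AddCommGroup B] [Module ℂ B]
  [AddCommGroup C] [Module ℂ C]

theorem mem_secantVariety_of_tendsto {r : ℕ} {T : A ⊗[ℂ] B ⊗[ℂ] C} (hT : T ≠ 0)
    {α : Type*} {l : Filter α} [l.NeBot] {w : α → A ⊗[ℂ] B ⊗[ℂ] C}
    (hw : ∀ φ : Module.Dual ℂ (A ⊗[ℂ] B ⊗[ℂ] C),
      Filter.Tendsto (fun t => φ (w t)) l (𝓝 (φ T)))
    (hS : ∀ᶠ t in l, TensorRankLE r (w t)) :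
    Projectivization.mk ℂ T hT ∈ secantVariety r (segre A B C) :=
  mem_zariskiClosure_of_tendsto hT hw (hS.mono fun _ ht h => (rank_segre_le_iff h).2 ht)

section Curve

variable {y : ℂ → A ⊗[ℂ] B ⊗[ℂ] C} {y₁ y₂ : A ⊗[ℂ] B ⊗[ℂ] C}

/-- A linear combination of points of a curve which approximates `y(0) + y'(0) + y''(0)`. -/
noncomputable def secantCombination (y : ℂ → A ⊗[ℂ] B ⊗[ℂ] C) (t : ℂ) : A ⊗[ℂ] B ⊗[ℂ] C :=
  (1 - 2 / t ^ 2) • y 0 + (1 / (2 * t) + 1 / t ^ 2) • y t + (1 / t ^ 2 - 1 / (2 * t)) • y (-t)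

theorem tendsto_secantCombination {φ : Module.Dual ℂ (A ⊗[ℂ] B ⊗[ℂ] C)}
    (hφ : HasJet (fun t => φ (y t)) (φ (y 0)) (φ y₁) (φ y₂ / 2)) :
    Filter.Tendsto (fun t => φ (secantCombination y t)) (𝓝[≠] (0 : ℂ)) (𝓝 (φ (y 0 + y₁ + y₂))) := by
  have h := hφ.tendsto
  rw [mul_div_cancel₀ _ (two_ne_zero' ℂ)] at h
  simpa only [secantCombination, map_add, map_smul, smul_eq_mul] using h

theorem eventually_decomposable_neg (hX : ∀ᶠ t in 𝓝 (0 : ℂ), y t ∈ affineCone (segre A B C)) :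
    ∀ᶠ t in 𝓝 (0 : ℂ), y (-t) ∈ affineCone (segre A B C) := by
  have hneg : Filter.Tendsto (fun t : ℂ => -t) (𝓝 0) (𝓝 0) := by
    simpa using (continuous_neg (G := ℂ)).tendsto 0
  exact hneg.eventually hX

theorem mem_secantVariety_three_of_jet
    (hj : ∀ φ : Module.Dual ℂ (A ⊗[ℂ] B ⊗[ℂ] C),
      HasJet (fun t => φ (y t)) (φ (y 0)) (φ y₁) (φ y₂ / 2))
    (hX : ∀ᶠ t in 𝓝 (0 : ℂ), y t ∈ affineCone (segre A B C)) (h : y 0 + y₁ + y₂ ≠ 0) :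
    Projectivization.mk ℂ _ h ∈ secantVariety 3 (segre A B C) := by
  refine mem_secantVariety_of_tendsto h (fun φ => tendsto_secantCombination (hj φ)) ?_
  obtain ⟨a₀, b₀, c₀, h₀⟩ := exists_eq_tmul_of_mem_affineCone hX.self_of_nhds
  filter_upwards [hX.filter_mono nhdsWithin_le_nhds,
    (eventually_decomposable_neg hX).filter_mono nhdsWithin_le_nhds] with t h₁ h₂
  obtain ⟨a₁, b₁, c₁, h₁⟩ := exists_eq_tmul_of_mem_affineCone h₁
  obtain ⟨a₂, b₂, c₂, h₂⟩ := exists_eq_tmul_of_mem_affineCone h₂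
  refine ⟨![(1 - 2 / t ^ 2) • a₀, (1 / (2 * t) + 1 / t ^ 2) • a₁, (1 / t ^ 2 - 1 / (2 * t)) • a₂],
    ![b₀, b₁, b₂], ![c₀, c₁, c₂], ?_⟩
  simp only [secantCombination, h₀, h₁, h₂, Fin.sum_univ_three, TensorProduct.smul_tmul']
  rfl

/-- When `y 0` vanishes, only `y t` and `y (-t)` remain in the finite difference. -/
theorem mem_secantVariety_two_of_jet
    (hj : ∀ φ : Module.Dual ℂ (A ⊗[ℂ] B ⊗[ℂ] C),
      HasJet (fun t => φ (y t)) (φ (y 0)) (φ y₁) (φ y₂ / 2))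
    (hX : ∀ᶠ t in 𝓝 (0 : ℂ), y t ∈ affineCone (segre A B C)) (h : y 0 + y₁ + y₂ ≠ 0)
    (h₀ : y 0 = 0) :
    Projectivization.mk ℂ _ h ∈ secantVariety 2 (segre A B C) := by
  refine mem_secantVariety_of_tendsto h (fun φ => tendsto_secantCombination (hj φ)) ?_
  filter_upwards [hX.filter_mono nhdsWithin_le_nhds,
    (eventually_decomposable_neg hX).filter_mono nhdsWithin_le_nhds] with t h₁ h₂
  obtain ⟨a₁, b₁, c₁, h₁⟩ := exists_eq_tmul_of_mem_affineCone h₁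
  obtain ⟨a₂, b₂, c₂, h₂⟩ := exists_eq_tmul_of_mem_affineCone h₂
  refine ⟨![(1 / (2 * t) + 1 / t ^ 2) • a₁, (1 / t ^ 2 - 1 / (2 * t)) • a₂],
    ![b₁, b₂], ![c₁, c₂], ?_⟩
  simp only [secantCombination, h₀, h₁, h₂, Fin.sum_univ_two, TensorProduct.smul_tmul', smul_zero,
    zero_add]
  rfl

open TensorProduct in
theorem not_isNondegenerate_of_mem_secantVariety_two [FiniteDimensional ℂ B]
    [FiniteDimensional ℂ C] {T : A ⊗[ℂ] B ⊗[ℂ] C} (hT : T ≠ 0)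
    (h : Projectivization.mk ℂ T hT ∈ secantVariety 2 (segre A B C)) :
    ¬ IsNondegenerate (Projectivization.mk ℂ T hT) := by
  intro hn
  obtain ⟨m, α, hm⟩ := exists_map_first_eq_of_mem_secantVariety hT h
  let A' := Submodule.span ℂ (Set.range m)
  have hmem : ∀ x, (∑ i, (α i).smulRight (m i)) x ∈ A' := fun x => by
    rw [LinearMap.sum_apply]
    exact sum_mem fun i _ => A'.smul_mem _ (Submodule.subset_span ⟨i, rfl⟩)
  have h3 := hn.1 A' (by
    rw [Projectivization.submodule_mk, Submodule.span_singleton_le_iff_mem]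
    refine ⟨map (map (LinearMap.codRestrict A' _ hmem) LinearMap.id) LinearMap.id T, ?_⟩
    rw [← LinearMap.comp_apply, ← map_comp, ← map_comp, LinearMap.subtype_comp_codRestrict,
      LinearMap.id_comp, LinearMap.id_comp, hm])
  have h2 : Module.finrank ℂ A' ≤ 2 := (finrank_range_le_card m).trans (by simp)
  omega

/-- Contraction of a tensor with linear forms in the last two factors. -/
noncomputable def contractFirst (β : Module.Dual ℂ B) (γ : Module.Dual ℂ C) :
    A ⊗[ℂ] B ⊗[ℂ] C →ₗ[ℂ] A :=
  TensorProduct.lift (LinearMap.flip (γ.smulRight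
    (TensorProduct.lift (LinearMap.flip (β.smulRight (LinearMap.id : A →ₗ[ℂ] A))))))

/-- Contraction of a tensor with linear forms in the outer two factors. -/
noncomputable def contractSecond (α : Module.Dual ℂ A) (γ : Module.Dual ℂ C) :
    A ⊗[ℂ] B ⊗[ℂ] C →ₗ[ℂ] B :=
  TensorProduct.lift (LinearMap.flip (γ.smulRight
    (TensorProduct.lift (α.smulRight (LinearMap.id : B →ₗ[ℂ] B)))))

/-- Contraction of a tensor with linear forms in the first two factors. -/
noncomputable def contractThird (α : Module.Dual ℂ A) (β : Module.Dual ℂ B) :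
    A ⊗[ℂ] B ⊗[ℂ] C →ₗ[ℂ] C :=
  TensorProduct.lift ((TensorProduct.dualDistrib ℂ A B (α ⊗ₜ β)).smulRight
    (LinearMap.id : C →ₗ[ℂ] C))

theorem apply_contractFirst (α : Module.Dual ℂ A) (β : Module.Dual ℂ B) (γ : Module.Dual ℂ C)
    (T : A ⊗[ℂ] B ⊗[ℂ] C) : α (contractFirst β γ T) = triForm α β γ T := by
  have : α ∘ₗ contractFirst β γ = triForm α β γ := by
    ext a b c
    simp [contractFirst]
    ring
  exact LinearMap.congr_fun this T

theorem apply_contractSecond (α : Module.Dual ℂ A) (β : Module.Dual ℂ B) (γ : Module.Dual ℂ C)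
    (T : A ⊗[ℂ] B ⊗[ℂ] C) : β (contractSecond α γ T) = triForm α β γ T := by
  have : β ∘ₗ contractSecond α γ = triForm α β γ := by
    ext a b c
    simp [contractSecond]
    ring
  exact LinearMap.congr_fun this T

theorem apply_contractThird (α : Module.Dual ℂ A) (β : Module.Dual ℂ B) (γ : Module.Dual ℂ C)
    (T : A ⊗[ℂ] B ⊗[ℂ] C) : γ (contractThird α β T) = triForm α β γ T := by
  have : γ ∘ₗ contractThird α β = triForm α β γ := by
    ext a b c
    simp [contractThird]
  exact LinearMap.congr_fun this T

theorem triForm_smul (d : ℂ) (α : Module.Dual ℂ A) (β : Module.Dual ℂ B)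
    (γ : Module.Dual ℂ C) : triForm (d • α) β γ = d • triForm α β γ := by
  ext a b c
  simp [mul_assoc]

/-- No analytic choice of factors of `y t` is needed: contractions recover them up to scale, and on
decomposable tensors `κ² · triForm α β γ` is the product of three contracted forms. Comparing
second-order jets of both sides gives the claim. -/
theorem exists_eq_osculatingTensor [FiniteDimensional ℂ A] [FiniteDimensional ℂ B]
    [FiniteDimensional ℂ C]
    (hj : ∀ φ : Module.Dual ℂ (A ⊗[ℂ] B ⊗[ℂ] C),
      HasJet (fun t => φ (y t)) (φ (y 0)) (φ y₁) (φ y₂ / 2))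
    (hX : ∀ᶠ t in 𝓝 (0 : ℂ), y t ∈ affineCone (segre A B C)) (h₀ : y 0 ≠ 0) :
    ∃ (x : Fin 3 → A) (z : Fin 3 → B) (w : Fin 3 → C),
      y 0 + y₁ + y₂ = osculatingTensor x z w := by
  obtain ⟨α₀, β₀, γ₀, hne⟩ : ∃ α β γ, triForm α β γ (y 0) ≠ 0 := by
    by_contra! h
    exact h₀ (eq_zero_of_forall_triForm_eq_zero h)
  wlog hone : triForm α₀ β₀ γ₀ (y 0) = 1 generalizing α₀
  · have hsmul : triForm ((triForm α₀ β₀ γ₀ (y 0))⁻¹ • α₀) β₀ γ₀ (y 0) = 1 := by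
      rw [triForm_smul, LinearMap.smul_apply, smul_eq_mul, inv_mul_cancel₀ hne]
    exact this _ (hsmul ▸ one_ne_zero) hsmul
  let κ := triForm α₀ β₀ γ₀
  let p := contractFirst (A := A) β₀ γ₀
  let q := contractSecond (B := B) α₀ γ₀
  let r := contractThird (C := C) α₀ β₀
  -- `s` and `e` are chosen so that twice the second-order relation, plus `s` times the first-order
  -- one, plus `e` times the zeroth-order one has left side `y 0 + y₁ + y₂`. The extra terms on the
  -- right are absorbed into the last vector of each triple.
  let s := 1 - 4 * κ y₁
  let e := 1 - 2 * (κ y₁ ^ 2 + κ y₂) - 2 * κ y₁ * s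
  refine ⟨![p (y 0), p y₁, p y₂ + s • p y₁ + e • p (y 0)], ![q (y 0), q y₁, q y₂ + s • q y₁],
    ![r (y 0), r y₁, r y₂ + s • r y₁], ?_⟩
  rw [← sub_eq_zero]
  refine eq_zero_of_forall_triForm_eq_zero fun α β γ => ?_
  have hL := ((hj κ).mul (hj κ)).mul (hj (triForm α β γ))
  have hR := ((hj (triForm α β₀ γ₀)).mul (hj (triForm α₀ β γ₀))).mul (hj (triForm α₀ β₀ γ))
  have heq : ∀ᶠ t in 𝓝 (0 : ℂ), κ (y t) * κ (y t) * triForm α β γ (y t) =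
      triForm α β₀ γ₀ (y t) * triForm α₀ β γ₀ (y t) * triForm α₀ β₀ γ (y t) := by
    filter_upwards [hX] with t ht
    obtain ⟨a, b, c, h⟩ := exists_eq_tmul_of_mem_affineCone ht
    simp only [κ, h, triForm_tmul]
    ring
  obtain ⟨e0, e1, e2⟩ := hL.unique (hR.congr heq)
  have hκ : κ (y 0) = 1 := hone
  rw [map_sub, triForm_osculatingTensor]
  simp only [map_add, map_smul, smul_eq_mul, Matrix.cons_val, p, q, r, apply_contractFirst,
    apply_contractSecond, apply_contractThird]
  simp only [hκ, one_mul, mul_one] at e0 e1 e2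
  simp only [e, s]
  linear_combination 2 * e2 + s * e1 + e * e0

open TensorProduct in
theorem IsNondegenerate.linearIndependent {x : Fin 3 → A} {y : Fin 3 → B} {z : Fin 3 → C}
    (h0 : osculatingTensor x y z ≠ 0)
    (h : IsNondegenerate (Projectivization.mk ℂ (osculatingTensor x y z) h0)) :
    LinearIndependent ℂ x ∧ LinearIndependent ℂ y ∧ LinearIndependent ℂ z := by
  obtain ⟨hA, hB, hC⟩ := h
  simp only [Projectivization.submodule_mk, Submodule.span_singleton_le_iff_mem] at hA hB hC
  refine ⟨?_, ?_, ?_⟩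
  · rw [linearIndependent_iff_card_le_finrank_span, Fintype.card_fin]
    have key : ∀ i b c, x i ⊗ₜ[ℂ] b ⊗ₜ[ℂ] c ∈ LinearMap.range (map (map
        (Submodule.span ℂ (Set.range x)).subtype (LinearMap.id : B →ₗ[ℂ] B))
        (LinearMap.id : C →ₗ[ℂ] C)) := fun i b c =>
      ⟨(⟨x i, Submodule.subset_span ⟨i, rfl⟩⟩ : Submodule.span ℂ (Set.range x)) ⊗ₜ b ⊗ₜ c, rfl⟩
    refine hA _ ?_
    exact add_mem (add_mem (add_mem (key _ _ _) (key _ _ _)) (key _ _ _))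
      (Submodule.smul_mem _ _ (add_mem (add_mem (key _ _ _) (key _ _ _)) (key _ _ _)))
  · rw [linearIndependent_iff_card_le_finrank_span, Fintype.card_fin]
    have key : ∀ a i c, a ⊗ₜ[ℂ] y i ⊗ₜ[ℂ] c ∈ LinearMap.range (map (map
        (LinearMap.id : A →ₗ[ℂ] A) (Submodule.span ℂ (Set.range y)).subtype)
        (LinearMap.id : C →ₗ[ℂ] C)) := fun a i c =>
      ⟨a ⊗ₜ (⟨y i, Submodule.subset_span ⟨i, rfl⟩⟩ : Submodule.span ℂ (Set.range y)) ⊗ₜ c, rfl⟩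
    refine hB _ ?_
    exact add_mem (add_mem (add_mem (key _ _ _) (key _ _ _)) (key _ _ _))
      (Submodule.smul_mem _ _ (add_mem (add_mem (key _ _ _) (key _ _ _)) (key _ _ _)))
  · rw [linearIndependent_iff_card_le_finrank_span, Fintype.card_fin]
    have key : ∀ a b i, a ⊗ₜ[ℂ] b ⊗ₜ[ℂ] z i ∈ LinearMap.range (map
        (LinearMap.id : A ⊗[ℂ] B →ₗ[ℂ] A ⊗[ℂ] B) (Submodule.span ℂ (Set.range z)).subtype) :=
      fun a b i => ⟨a ⊗ₜ b ⊗ₜ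
        (⟨z i, Submodule.subset_span ⟨i, rfl⟩⟩ : Submodule.span ℂ (Set.range z)), rfl⟩
    refine hC _ ?_
    exact add_mem (add_mem (add_mem (key _ _ _) (key _ _ _)) (key _ _ _))
      (Submodule.smul_mem _ _ (add_mem (add_mem (key _ _ _) (key _ _ _)) (key _ _ _)))

end Curve

theorem rank_osculatingTensor [FiniteDimensional ℂ A] [FiniteDimensional ℂ B]
    [FiniteDimensional ℂ C] {x : Fin 3 → A} {y : Fin 3 → B} {z : Fin 3 → C}
    (h0 : osculatingTensor x y z ≠ 0)
    (hmem : Projectivization.mk ℂ _ h0 ∈ secantVariety 3 (segre A B C))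
    (hx : LinearIndependent ℂ x) (hy : LinearIndependent ℂ y) (hz : LinearIndependent ℂ z) :
    rank (segre A B C) (Projectivization.mk ℂ _ h0) = 5 := by
  refine le_antisymm ((rank_segre_le_iff (r := 5) h0).2
    (tensorRankLE_five_of_mem_secantVariety h0 hmem)) ?_
  have h4 : ((4 : ℕ) : ℕ∞) < rank (segre A B C) (Projectivization.mk ℂ _ h0) := by
    rw [← not_le, rank_segre_le_iff]
    exact not_tensorRankLE_four_osculatingTensor hx hy hz
  exact Order.add_one_le_of_lt h4

theorem osculatingTensor_ne_zero {x : Fin 3 → A} {y : Fin 3 → B} {z : Fin 3 → C}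
    (hx : LinearIndependent ℂ x) (hy : LinearIndependent ℂ y) (hz : LinearIndependent ℂ z) :
    osculatingTensor x y z ≠ 0 := fun h =>
  not_tensorRankLE_four_osculatingTensor hx hy hz ⟨0, 0, 0, by simp [h]⟩

open TensorProduct in
theorem osculatingTensor_mem_secantVariety {x : Fin 3 → A} {y : Fin 3 → B} {z : Fin 3 → C}
    (h0 : osculatingTensor x y z ≠ 0) :
    Projectivization.mk ℂ _ h0 ∈ secantVariety 3 (segre A B C) := by
  -- The quadratic coefficients are chosen so that `Y''(0)` cancels `Y(0) + Y'(0)` and supplies the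
  -- terms with `x 2`, `y 2`, `z 2`.
  let u := (1 / 2 : ℂ) • (x 2 - x 1 - x 0)
  let v := (1 / 2 : ℂ) • (y 2 - y 1)
  let w := (1 / 2 : ℂ) • (z 2 - z 1)
  let Y : ℂ → A ⊗[ℂ] B ⊗[ℂ] C := fun t => (x 0 + t • x 1 + t ^ 2 • u) ⊗ₜ[ℂ]
    (y 0 + t • y 1 + t ^ 2 • v) ⊗ₜ[ℂ] (z 0 + t • z 1 + t ^ 2 • w)
  let y₁ := x 1 ⊗ₜ[ℂ] y 0 ⊗ₜ[ℂ] z 0 + x 0 ⊗ₜ[ℂ] y 1 ⊗ₜ[ℂ] z 0 + x 0 ⊗ₜ[ℂ] y 0 ⊗ₜ[ℂ] z 1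
  let y₂ := (2 : ℂ) • (u ⊗ₜ[ℂ] y 0 ⊗ₜ[ℂ] z 0 + x 0 ⊗ₜ[ℂ] v ⊗ₜ[ℂ] z 0 + x 0 ⊗ₜ[ℂ] y 0 ⊗ₜ[ℂ] w +
    x 1 ⊗ₜ[ℂ] y 1 ⊗ₜ[ℂ] z 0 + x 1 ⊗ₜ[ℂ] y 0 ⊗ₜ[ℂ] z 1 + x 0 ⊗ₜ[ℂ] y 1 ⊗ₜ[ℂ] z 1)
  have hsum : Y 0 + y₁ + y₂ = osculatingTensor x y z := by
    simp only [Y, y₁, y₂, u, v, w, osculatingTensor, tmul_smul, ← smul_tmul', tmul_sub, sub_tmul,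
      tmul_add, add_tmul]
    module
  have hj : ∀ φ : Module.Dual ℂ (A ⊗[ℂ] B ⊗[ℂ] C),
      HasJet (fun t => φ (Y t)) (φ (Y 0)) (φ y₁) (φ y₂ / 2) := by
    intro φ
    let f : A → B → C → ℂ := fun a b c => φ (a ⊗ₜ b ⊗ₜ c)
    refine ⟨fun t => (f u (y 0) (z 0) + f (x 0) v (z 0) + f (x 0) (y 0) w + f (x 1) (y 1) (z 0) +
        f (x 1) (y 0) (z 1) + f (x 0) (y 1) (z 1)) +
      t * (f (x 1) (y 1) (z 1) + f u (y 1) (z 0) + f u (y 0) (z 1) + f (x 1) v (z 0) +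
        f (x 0) v (z 1) + f (x 1) (y 0) w + f (x 0) (y 1) w) +
      t ^ 2 * (f u (y 1) (z 1) + f (x 1) v (z 1) + f (x 1) (y 1) w + f u v (z 0) +
        f u (y 0) w + f (x 0) v w) +
      t ^ 3 * (f u v (z 1) + f u (y 1) w + f (x 1) v w) + t ^ 4 * f u v w,
      by fun_prop, ?_, Filter.Eventually.of_forall fun t => ?_⟩
    · simp only [y₂, f, map_smul, map_add, smul_eq_mul]
      ring
    · simp only [Y, y₁, f, tmul_smul, ← smul_tmul', tmul_add, add_tmul, map_smul, map_add,
        smul_eq_mul]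
      ring
  generalize osculatingTensor x y z = T at *
  subst hsum
  exact mem_secantVariety_three_of_jet hj
    (Filter.Eventually.of_forall fun t => tmul_mem_affineCone _ _ _) h0

end SecondOrder

end SegreSecant

theorem corollary7p3 {A B C : Type*}
    [AddCommGroup A] [Module ℂ A] [FiniteDimensional ℂ A]
    [AddCommGroup B] [Module ℂ B] [FiniteDimensional ℂ B]
    [AddCommGroup C] [Module ℂ C] [FiniteDimensional ℂ C] :
    (∀ p : Projectivization ℂ (A ⊗[ℂ] B ⊗[ℂ] C),
      SegreSecant.IsSecondOrderPoint (SegreSecant.segre A B C) p →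
        p ∈ SegreSecant.secantVariety 3 (SegreSecant.segre A B C) ∧
        (SegreSecant.IsNondegenerate p → SegreSecant.rank (SegreSecant.segre A B C) p = 5)) ∧
    (∀ p ∈ SegreSecant.secantVariety 3 (SegreSecant.segre A B C),
      SegreSecant.rank (SegreSecant.segre A B C) p ≤ 5) ∧
    (3 ≤ Module.finrank ℂ A → 3 ≤ Module.finrank ℂ B → 3 ≤ Module.finrank ℂ C →
      ∃ p ∈ SegreSecant.secantVariety 3 (SegreSecant.segre A B C),
        SegreSecant.rank (SegreSecant.segre A B C) p = 5) := by
  refine ⟨?_, ?_, ?_⟩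
  · rintro p ⟨y, y₁, y₂, han, hX, h₁, h₂, h, rfl⟩
    have hj : ∀ φ : Module.Dual ℂ (A ⊗[ℂ] B ⊗[ℂ] C),
        SegreSecant.HasJet (fun t => φ (y t)) (φ (y 0)) (φ y₁) (φ y₂ / 2) := fun φ => by
      rw [h₁, h₂]
      exact SegreSecant.hasJet_of_analyticAt (han φ)
    have hmem := SegreSecant.mem_secantVariety_three_of_jet hj hX h
    refine ⟨hmem, fun hn => ?_⟩
    by_cases h₀ : y 0 = 0
    · exact absurd hn (SegreSecant.not_isNondegenerate_of_mem_secantVariety_two h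
        (SegreSecant.mem_secantVariety_two_of_jet hj hX h h₀))
    · obtain ⟨a, b, c, he⟩ := SegreSecant.exists_eq_osculatingTensor hj hX h₀
      generalize hT : y 0 + y₁ + y₂ = T at *
      subst he
      obtain ⟨ha, hb, hc⟩ := hn.linearIndependent
      exact SegreSecant.rank_osculatingTensor h hmem ha hb hc
  · intro p
    induction p using Projectivization.ind with
    | h T hT =>
      exact fun h => (SegreSecant.rank_segre_le_iff (r := 5) hT).2
        (SegreSecant.tensorRankLE_five_of_mem_secantVariety hT h)
  · intro hA hB hC
    have hx := (Module.finBasis ℂ A).linearIndependent.comp _ (Fin.castLE_injective hA)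
    have hy := (Module.finBasis ℂ B).linearIndependent.comp _ (Fin.castLE_injective hB)
    have hz := (Module.finBasis ℂ C).linearIndependent.comp _ (Fin.castLE_injective hC)
    have h0 := SegreSecant.osculatingTensor_ne_zero hx hy hz
    have hmem := SegreSecant.osculatingTensor_mem_secantVariety h0
    exact ⟨_, hmem, SegreSecant.rank_osculatingTensor h0 hmem hx hy hz⟩
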